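/- **Theorem 3.5 (error estimate).** *Setting.* Let $d\ge 1$, let $\Omega\subset\mathbb R^d$ be open, bounded and strictly convex ($\Omega$ is convex and the open segment between two distinct points of $\overline\Omega$ lies in the interior of $\overline\Omega$), and let $f:\overline\Omega\to\mathbb R$ be continuous. Let $u$ be the convex envelope of $f$, $u(x)=\sup\{l(x): l \text{ affine},\ l\le f \text{ in } \overline\Omega\}$, or a viscosity solution $u\in C(\overline\Omega)$ of $\min\{f-u,\lambda_1[D^2u]\}=0$ in $\Omega$, $u=f$ on $\partial\Omega$, where $\lambda_1$ is the smallest eigenvalue. Let $\mathcal T_h$ be a nonempty finite conforming mesh of closed $d$-simplices, with mesh size $h=\max_T h_T$, that is shape-regular and quasi-uniform with constant $\sigma$: $h_T/\rho_T\le\sigma$ and $h\le\sigma h_T$ for all $T\in\mathcal T_h$, where $h_T$ is the diameter of $T$ and $\rho_T$ that of the largest ball contained in $T$. Let $\Omega_h$ be the interior of the union of the elements, and assume that every node on $\partial\Omega_h$ lies on $\partial\Omega$. The boundary nodes $\mathcal N_h^b$ are the nodes on $\partial\Omega$, the interior nodes $\mathcal N_h^0$ are all the others, $\mathbb V_h$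 is the space of continuous piecewise linear functions over $\mathcal T_h$, and $\mathcal I_h$ is the Lagrange interpolation operator onto $\mathbb V_h$. Let $\delta\ge h$, and let $\mathbb S_\theta$ be a finite set of unit vectors such that for every unit vector $v$ there is $v^\theta\in\mathbb S_\theta$ with $|v-v^\theta|\le\theta$. For $x_i\in\mathcal N_h^0$ put $\delta_i=\min\{\delta,\operatorname{dist}(x_i,\partial\Omega_h)\}$ and $$\nabla^2_\delta w(x_i;v)=\frac{w(x_i+\delta_iv)-2w(x_i)+w(x_i-\delta_iv)}{\delta_i^2}.$$ The discrete solution $u_\varepsilon\in\mathbb V_h$, $\varepsilon=(h,\delta,\theta)$, is given by $$\min\Big\{f(x_i)-u_\varepsilon(x_i),\ \min_{v\in\mathbb S_\theta}\nabla^2_\delta u_\varepsilon(x_i;v)\Big\}=0\quad\forall x_i\in\mathcal N_h^0,\qquad u_\varepsilon(x_i)=f(x_i)\quad\forall x_i\in\mathcal N_h^b .$$ For $k\in\{0,1\}$ and $0<\alpha\le1$, $|w|_{C^{k,\alpha}(\overline\Omega)}$ denotes the $\alpha$-Hölder seminorm of the derivative of order $k$ of $w$. *Claim.* There is a constant $C$,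 depending only on $\Omega$, $d$ and $\sigma$, such that the following holds for all data as above. If $k\in\{0,1\}$, $0<\alpha\le1$, $u,f\in C^{k,\alpha}(\overline\Omega)$ and $\theta\le1$, then $$\|\mathcal I_hu-u_\varepsilon\|_{L^\infty(\Omega_h)}\le C\left[|u|_{C^{k,\alpha}(\overline\Omega)}\,\frac{(\delta\theta)^{k+\alpha}+h^{k+\alpha}+\delta^{2+k+\alpha}}{\delta^2}+|f|_{C^{k,\alpha}(\overline\Omega)}\,\delta^{k+\alpha}\right].$$ -/

import Mathlib

namespace TwoScale

noncomputable section

/-- The Euclidean space `ℝ^d`. -/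
abbrev Eu (d : ℕ) : Type := EuclideanSpace ℝ (Fin d)

/-! ### Hölder classes -/

/-- `w` belongs to `C^{k,α}` of the closure of `Ω`: it is continuous on the closure, `C^k` in the
open set `Ω`, and its derivative of order `k` is `α`-Hölder in `Ω` (hence has a Hölder continuous
extension to the closure). Values of `w` outside the closure of `Ω` play no role. -/
structure IsHolder {d : ℕ} (k : ℕ) (α : ℝ) (Ω : Set (Eu d)) (w : Eu d → ℝ) : Prop where
  continuousOn : ContinuousOn w (closure Ω)
  contDiffOn : ContDiffOn ℝ k w Ω
  holder : ∃ K : ℝ, ∀ x ∈ Ω, ∀ y ∈ Ω,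
    ‖iteratedFDeriv ℝ k w x - iteratedFDeriv ℝ k w y‖ ≤ K * dist x y ^ α

/-- The seminorm `|w|_{C^{k,α}}`: the best `α`-Hölder constant of the derivative of order `k`
(by continuity the supremum over `Ω` is the one over its closure). -/
def holderSeminorm {d : ℕ} (k : ℕ) (α : ℝ) (Ω : Set (Eu d)) (w : Eu d → ℝ) : ℝ :=
  sSup {q : ℝ | ∃ x ∈ Ω, ∃ y ∈ Ω, x ≠ y ∧
    q = ‖iteratedFDeriv ℝ k w x - iteratedFDeriv ℝ k w y‖ / dist x y ^ α}

/-! ### The convex envelope and its obstacle problem -/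

/-- The convex envelope `x ↦ sup {l(x) : l affine, l ≤ f on the closure of Ω}`. -/
def convexEnvelope {d : ℕ} (Ω : Set (Eu d)) (f : Eu d → ℝ) (x : Eu d) : ℝ :=
  sSup {t : ℝ | ∃ l : Eu d →ᵃ[ℝ] ℝ, (∀ y ∈ closure Ω, l y ≤ f y) ∧ t = l x}

/-- The smallest eigenvalue of the Hessian of `φ` at `x`, as the minimum of the second directional
derivatives `∂²_{vv} φ(x)` over unit vectors `v`. -/
def lambdaOne {d : ℕ} (φ : Eu d → ℝ) (x : Eu d) : ℝ :=
  sInf {t : ℝ | ∃ v : Eu d, ‖v‖ = 1 ∧ t = iteratedFDeriv ℝ 2 φ x ![v, v]}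

/-- `u` is a viscosity solution of `min {f - u, λ₁[D²u]} = 0` in the open set `Ω`, with `u = f` on
its boundary. -/
structure IsViscositySolution {d : ℕ} (Ω : Set (Eu d)) (f u : Eu d → ℝ) : Prop where
  continuousOn : ContinuousOn u (closure Ω)
  subsolution : ∀ x ∈ Ω, ∀ φ : Eu d → ℝ, ContDiffOn ℝ 2 φ Ω →
    IsLocalMax (fun y => u y - φ y) x → 0 ≤ min (f x - u x) (lambdaOne φ x)
  supersolution : ∀ x ∈ Ω, ∀ φ : Eu d → ℝ, ContDiffOn ℝ 2 φ Ω →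
    IsLocalMin (fun y => u y - φ y) x → min (f x - u x) (lambdaOne φ x) ≤ 0
  boundary : ∀ x ∈ frontier Ω, u x = f x

/-! ### Meshes and piecewise linear functions -/

/-- A (conforming) mesh of closed `d`-simplices in `ℝ^d`: a nonempty finite simplicial complex all
of whose faces are faces of `d`-dimensional ones. A simplex is recorded by its set of vertices. -/
structure Mesh (d : ℕ) where
  complex : Geometry.SimplicialComplex ℝ (Eu d)
  nonempty : complex.faces.Nonempty
  finite : complex.faces.Finite
  pure : ∀ s ∈ complex.faces, ∃ t ∈ complex.faces, s ⊆ t ∧ t.card = d + 1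

/-- The closed simplex with vertex set `s`. -/
abbrev simplexSet {d : ℕ} (s : Finset (Eu d)) : Set (Eu d) := convexHull ℝ (s : Set (Eu d))

/-- `h_T`, the diameter of the simplex `T`. -/
def simplexDiam {d : ℕ} (s : Finset (Eu d)) : ℝ := Metric.diam (simplexSet s)

/-- `ρ_T`, the diameter of the largest ball contained in the simplex `T`. -/
def inballDiam {d : ℕ} (s : Finset (Eu d)) : ℝ :=
  sSup {ρ : ℝ | 0 ≤ ρ ∧ ∃ c : Eu d, Metric.closedBall c (ρ / 2) ⊆ simplexSet s}

namespace Mesh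

variable {d : ℕ}

/-- The elements `T`, that is, the `d`-dimensional simplices. -/
def elements (M : Mesh d) : Set (Finset (Eu d)) := {s ∈ M.complex.faces | s.card = d + 1}

/-- `Ω_h`, the interior of the union of the elements. -/
def domain (M : Mesh d) : Set (Eu d) := interior (⋃ s ∈ M.elements, simplexSet s)

/-- The nodes. -/
def nodes (M : Mesh d) : Set (Eu d) := {x | ∃ s ∈ M.elements, x ∈ s}

/-- The boundary nodes: the nodes on the boundary of `Ω`. -/
def boundaryNodes (M : Mesh d) (Ω : Set (Eu d)) : Set (Eu d) := M.nodes ∩ frontier Ω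

/-- The interior nodes: all the other ones. -/
def interiorNodes (M : Mesh d) (Ω : Set (Eu d)) : Set (Eu d) := M.nodes \ M.boundaryNodes Ω

/-- The mesh size `h`, the largest diameter of an element. -/
def size (M : Mesh d) : ℝ := sSup (simplexDiam '' M.elements)

/-- Shape regularity `h_T / ρ_T ≤ σ` and quasi-uniformity `h ≤ σ h_T`, for all elements `T`. -/
def IsRegular (M : Mesh d) (σ : ℝ) : Prop :=
  ∀ s ∈ M.elements, simplexDiam s / inballDiam s ≤ σ ∧ M.size ≤ σ * simplexDiam s

/-- The mesh is fitted to `Ω`: the nodes on the boundary of `Ω_h` lie on the boundary of `Ω`. -/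
def IsFitted (M : Mesh d) (Ω : Set (Eu d)) : Prop :=
  ∀ z ∈ M.nodes, z ∈ frontier M.domain → z ∈ frontier Ω

/-- The space `V_h` of continuous piecewise linear functions on the closure of `Ω_h` (values
elsewhere are irrelevant). -/
structure IsPiecewiseLinear (M : Mesh d) (w : Eu d → ℝ) : Prop where
  continuousOn : ContinuousOn w (closure M.domain)
  affine : ∀ s ∈ M.elements, ∃ l : Eu d →ᵃ[ℝ] ℝ, Set.EqOn w l (simplexSet s)

/-- The Lagrange interpolant `I_h w`: at a point `x = ∑ λ_z z` of an element, written in the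
barycentric coordinates of that element, its value is `∑ λ_z w(z)`. The set below is a singleton
for every `x` in the union of the elements, as the mesh is conforming. -/
def interpolant (M : Mesh d) (w : Eu d → ℝ) (x : Eu d) : ℝ :=
  sInf {t : ℝ | ∃ s ∈ M.elements, ∃ c : Eu d → ℝ, (∀ z ∈ s, 0 ≤ c z) ∧ ∑ z ∈ s, c z = 1 ∧
    ∑ z ∈ s, c z • z = x ∧ t = ∑ z ∈ s, c z * w z}

/-- `δ_i = min {δ, dist(x_i, ∂Ω_h)}`. -/
def localScale (M : Mesh d) (δ : ℝ) (x : Eu d) : ℝ :=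
  min δ (Metric.infDist x (frontier M.domain))

/-- The centered second difference of `w` at `x` in the direction `v`, with step `δ_i`. -/
def secondDiff (M : Mesh d) (δ : ℝ) (w : Eu d → ℝ) (x v : Eu d) : ℝ :=
  (w (x + M.localScale δ x • v) - 2 * w x + w (x - M.localScale δ x • v)) /
    M.localScale δ x ^ 2

end Mesh

/-! ### The two-scale method -/

/-- A finite discretization `S_θ` of the unit sphere: each unit vector is within `θ` of it. -/
structure Directions (d : ℕ) (θ : ℝ) where
  dirs : Finset (Eu d)
  nonempty : dirs.Nonempty
  norm_eq_one : ∀ v ∈ dirs, ‖v‖ = 1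
  cover : ∀ v : Eu d, ‖v‖ = 1 → ∃ v' ∈ dirs, ‖v - v'‖ ≤ θ

/-- The operator `T_ε[w; f](x) = min {f(x) - w(x), min_{v ∈ S_θ} (second difference of w)}`. -/
def twoScaleOp {d : ℕ} (M : Mesh d) (δ : ℝ) {θ : ℝ} (S : Directions d θ) (f w : Eu d → ℝ)
    (x : Eu d) : ℝ :=
  min (f x - w x) (S.dirs.inf' S.nonempty fun v => M.secondDiff δ w x v)

/-- `w` is a discrete solution: `w ∈ V_h`, `T_ε[w; f] = 0` at the interior nodes, `w = f` at the
boundary nodes. -/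
structure IsDiscreteSolution {d : ℕ} (Ω : Set (Eu d)) (M : Mesh d) (δ : ℝ) {θ : ℝ}
    (S : Directions d θ) (f w : Eu d → ℝ) : Prop where
  piecewiseLinear : M.IsPiecewiseLinear w
  interior : ∀ x ∈ M.interiorNodes Ω, twoScaleOp M δ S f w x = 0
  boundary : ∀ x ∈ M.boundaryNodes Ω, w x = f x

end

end TwoScale

namespace TwoScale

open Set Filter Topology

/-! The nodal error is bounded on both sides by discrete comparison, and piecewise linearity carries
the bound to `Ω_h`.

Both notions of solution enter only through `IsEnvelope`: `u` is convex and continuous, lies below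
`f`, agrees with `f` on the boundary, and at interior points lies above every strictly convex
paraboloid `l + η‖· - x‖²` below `f`, evaluated at its center `x`. Convexity makes the interpolant
of `u` a discrete subsolution, whence `u ≤ uε` at the nodes (`envelope_le`).

For the opposite bound (`sub_le`), `uε - u + G` is maximized over the nodes with a convex `G = K b +
E‖·‖²`, whose second differences must beat those of the interpolant wherever `f - u` is not small.
Let `U` be the seminorm of `u`.

At distance at least `(d+2)δ` from the boundary, `x` is in the convex hull of the contact set of a
supporting affine `l` (`mem_convexHull_contact`). By Carathéodory (`exists_contact`), either a
contact point is within `dδ` of `x`, and `f - u = O(δ^(k+α))` because contact is tangential, or `u =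
l` on a segment of half-length `δ` centered at `x`. In the second case Taylor expansion at the two
ends bounds the undivided second difference by `2U(δθ+h)^(k+α)`; the quadratic part of `G` absorbs
it with `E` of order `U(δθ+h)^(k+α)/δ²`.

Near the boundary and for `k = 0`, the gap is `O(δ^α)` since `u = f` on the boundary. For `k = 1`
the local scale `r` may be of order `h`, and an error `r^(1+α)` is too large for the quadratic.
There the barrier `b = profile (dist/ρ)` acts: `r` is comparable to the distance to the boundary, so
in an almost normal direction the second difference of `b` is at least of order `r/δ`. A factor `K`
of order `U δ^(1+α)` suffices, and costs only `K` because `b ≤ 1`. -/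

theorem nontrivial_eu {d : ℕ} (hd : 1 ≤ d) : Nontrivial (Eu d) := by
  have : Nonempty (Fin d) := ⟨⟨0, hd⟩⟩
  infer_instance

theorem exists_norm_eq_one {d : ℕ} (hd : 1 ≤ d) : ∃ v : Eu d, ‖v‖ = 1 := by
  have := nontrivial_eu hd
  exact exists_norm_eq (Eu d) zero_le_one

/-! ### Geometry of simplicial meshes. -/

namespace Mesh

variable {d : ℕ} (M : Mesh d)

/-- The union of the closed elements. -/
def carrier : Set (Eu d) := ⋃ s ∈ M.elements, simplexSet s

variable {M}

theorem mem_carrier {x : Eu d} : x ∈ M.carrier ↔ ∃ s ∈ M.elements, x ∈ simplexSet s := by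
  simp [carrier]

theorem finite_elements : M.elements.Finite := M.finite.subset fun _ h => h.1

theorem nonempty_elements : M.elements.Nonempty := by
  obtain ⟨s, hs⟩ := M.nonempty
  obtain ⟨t, ht, -, h⟩ := M.pure s hs
  exact ⟨t, ht, h⟩

theorem nonempty_of_mem_elements {s : Finset (Eu d)} (hs : s ∈ M.elements) : s.Nonempty :=
  Finset.card_pos.1 (by rw [hs.2]; omega)

theorem finite_nodes : M.nodes.Finite := by
  have : M.nodes = ⋃ s ∈ M.elements, (s : Set (Eu d)) := by
    ext x; simp [nodes]
  rw [this]
  exact M.finite_elements.biUnion fun s _ => s.finite_toSet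

theorem nonempty_nodes : M.nodes.Nonempty := by
  obtain ⟨s, hs⟩ := M.nonempty_elements
  obtain ⟨x, hx⟩ := nonempty_of_mem_elements hs
  exact ⟨x, s, hs, hx⟩

theorem isCompact_simplexSet (s : Finset (Eu d)) : IsCompact (simplexSet s) :=
  s.finite_toSet.isCompact_convexHull ℝ

theorem isCompact_carrier : IsCompact M.carrier :=
  M.finite_elements.isCompact_biUnion fun s _ => isCompact_simplexSet s

theorem mem_simplexSet_of_mem {s : Finset (Eu d)} {x : Eu d} (hx : x ∈ s) : x ∈ simplexSet s :=
  subset_convexHull ℝ _ hx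

theorem isOpen_domain : IsOpen M.domain := isOpen_interior

theorem domain_subset_carrier : M.domain ⊆ M.carrier := interior_subset

theorem simplexSet_subset_carrier {s : Finset (Eu d)} (hs : s ∈ M.elements) :
    simplexSet s ⊆ M.carrier := subset_biUnion_of_mem (u := fun s => simplexSet s) hs

/-- The barycentric coordinates of an element. -/
theorem exists_coords {s : Finset (Eu d)} (hs : s ∈ M.elements) :
    ∃ c : Eu d → (Eu d →ᵃ[ℝ] ℝ), (∀ y, y ∈ simplexSet s ↔ ∀ z ∈ s, 0 ≤ c z y) ∧
      (∀ y, ∑ z ∈ s, c z y = 1) ∧ (∀ y, ∑ z ∈ s, c z y • z = y) ∧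
      ∀ z ∈ s, ∀ z' ∈ s, c z z' = if z = z' then 1 else 0 := by
  classical
  have hind := M.complex.indep hs.1
  have htop : affineSpan ℝ (range ((↑) : s → Eu d)) = ⊤ := by
    rw [hind.affineSpan_eq_top_iff_card_eq_finrank_add_one]
    simpa using hs.2
  let b : AffineBasis s ℝ (Eu d) := ⟨(↑), hind, htop⟩
  have hb : ∀ i : s, b i = i := fun _ => rfl
  refine ⟨fun z => if h : z ∈ s then b.coord ⟨z, h⟩ else 0, fun y => ?_, fun y => ?_,
    fun y => ?_, fun z hz z' hz' => ?_⟩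
  · have h := b.convexHull_eq_nonneg_coord
    have hr : range b = (s : Set (Eu d)) := Subtype.range_coe
    rw [hr] at h
    change y ∈ convexHull ℝ (s : Set (Eu d)) ↔ _
    rw [h]
    constructor
    · intro hy z hz
      simpa [hz] using hy ⟨z, hz⟩
    · intro hy i
      simpa using hy i i.2
  · rw [← b.sum_coord_apply_eq_one y, ← Finset.sum_coe_sort s]
    exact Finset.sum_congr rfl fun i _ => by simp
  · conv_rhs => rw [← b.linear_combination_coord_eq_self y]
    rw [← Finset.sum_coe_sort s]
    exact Finset.sum_congr rfl fun i _ => by simp [hb]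
  · have := b.coord_apply ⟨z, hz⟩ ⟨z', hz'⟩
    simp only [hz, dite_true]
    rw [hb] at this
    simpa using this

theorem nonempty_interior_simplexSet {s : Finset (Eu d)} (hs : s ∈ M.elements) :
    (interior (simplexSet s)).Nonempty := by
  have hind := M.complex.indep hs.1
  rw [interior_convexHull_nonempty_iff_affineSpan_eq_top]
  have : affineSpan ℝ (range ((↑) : s → Eu d)) = ⊤ := by
    rw [hind.affineSpan_eq_top_iff_card_eq_finrank_add_one]
    simpa using hs.2
  rwa [Subtype.range_coe] at this

theorem carrier_subset_closure_domain : M.carrier ⊆ closure M.domain := by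
  intro x hx
  obtain ⟨s, hs, hx⟩ := mem_carrier.1 hx
  have h := (convex_convexHull ℝ (s : Set (Eu d))).closure_interior_eq_closure_of_nonempty_interior
    (nonempty_interior_simplexSet hs)
  have : x ∈ closure (interior (simplexSet s)) := by
    rw [h]; exact subset_closure hx
  exact closure_mono (interior_mono (simplexSet_subset_carrier hs)) this

theorem nodes_subset_carrier : M.nodes ⊆ M.carrier := by
  rintro x ⟨s, hs, hx⟩
  exact simplexSet_subset_carrier hs (mem_simplexSet_of_mem hx)

theorem closure_domain_subset_carrier : closure M.domain ⊆ M.carrier :=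
  closure_minimal domain_subset_carrier isCompact_carrier.isClosed

theorem nonempty_domain : M.domain.Nonempty := by
  obtain ⟨s, hs⟩ := M.nonempty_elements
  exact (nonempty_interior_simplexSet hs).mono (interior_mono (simplexSet_subset_carrier hs))

theorem nonempty_frontier_domain (hd : 1 ≤ d) : (frontier M.domain).Nonempty := by
  have := nontrivial_eu hd
  rw [nonempty_frontier_iff]
  refine ⟨nonempty_domain, fun h => ?_⟩
  have : IsCompact (univ : Set (Eu d)) :=
    isCompact_carrier.of_isClosed_subset isClosed_univ (h ▸ domain_subset_carrier)
  exact noncompact_univ (Eu d) this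

/-- The ball is connected, misses the frontier and meets the domain at its center, so it cannot
reach the exterior. -/
theorem ball_infDist_frontier_subset {x : Eu d} (hx : x ∈ M.domain) :
    Metric.ball x (Metric.infDist x (frontier M.domain)) ⊆ M.domain := by
  rcases (Metric.infDist_nonneg (x := x) (s := frontier M.domain)).eq_or_lt with h | h
  · rw [← h]; simp
  refine (convex_ball x _).isPreconnected.subset_left_of_subset_union isOpen_domain
    (v := (closure M.domain)ᶜ) isClosed_closure.isOpen_compl
    (disjoint_compl_right.mono_left subset_closure) (fun y hy => ?_)
    ⟨x, Metric.mem_ball_self h, hx⟩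
  by_contra hy'
  have : y ∈ frontier M.domain := by
    rw [isOpen_domain.frontier_eq]
    simp only [Set.mem_union, mem_compl_iff, not_or, not_not] at hy'
    exact ⟨hy'.2, hy'.1⟩
  have hlt : dist x y < Metric.infDist x (frontier M.domain) := by
    rw [dist_comm]; exact Metric.mem_ball.1 hy
  exact Metric.notMem_of_dist_lt_infDist hlt this

theorem infDist_frontier_pos (hd : 1 ≤ d) {x : Eu d} (hx : x ∈ M.domain) :
    0 < Metric.infDist x (frontier M.domain) := by
  rw [← isClosed_frontier.notMem_iff_infDist_pos (nonempty_frontier_domain hd)]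
  rw [isOpen_domain.frontier_eq]
  exact fun h => h.2 hx

theorem closedBall_infDist_frontier_subset (hd : 1 ≤ d) {x : Eu d} (hx : x ∈ M.domain) :
    Metric.closedBall x (Metric.infDist x (frontier M.domain)) ⊆ M.carrier := by
  rw [← closure_ball x (infDist_frontier_pos hd hx).ne']
  exact closure_minimal ((ball_infDist_frontier_subset hx).trans domain_subset_carrier)
    isCompact_carrier.isClosed

/-! ### Sizes -/

theorem simplexDiam_le_size {s : Finset (Eu d)} (hs : s ∈ M.elements) :
    simplexDiam s ≤ M.size :=
  le_csSup (M.finite_elements.image _).bddAbove ⟨s, hs, rfl⟩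

theorem dist_le_size {s : Finset (Eu d)} (hs : s ∈ M.elements) {x y : Eu d}
    (hx : x ∈ simplexSet s) (hy : y ∈ simplexSet s) : dist x y ≤ M.size :=
  (Metric.dist_le_diam_of_mem (isCompact_simplexSet s).isBounded hx hy).trans
    (simplexDiam_le_size hs)

theorem le_simplexDiam (hd : 1 ≤ d) {s : Finset (Eu d)} {ρ : ℝ} (hρ : 0 ≤ ρ) {c : Eu d}
    (h : Metric.closedBall c (ρ / 2) ⊆ simplexSet s) : ρ ≤ simplexDiam s := by
  have := nontrivial_eu hd
  have := Metric.diam_mono h (isCompact_simplexSet s).isBounded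
  rw [Metric.diam_closedBall_eq _ (by positivity)] at this
  rw [simplexDiam]; linarith

theorem inballDiam_pos (hd : 1 ≤ d) {s : Finset (Eu d)} (hs : s ∈ M.elements) :
    0 < inballDiam s := by
  obtain ⟨c, hc⟩ := nonempty_interior_simplexSet hs
  obtain ⟨r, hr, h⟩ := Metric.nhds_basis_closedBall.mem_iff.1 (mem_interior_iff_mem_nhds.1 hc)
  have h2 : 2 * r ≤ inballDiam s :=
    le_csSup ⟨simplexDiam s, fun ρ ⟨hρ, c, h⟩ => le_simplexDiam hd hρ h⟩
      ⟨by positivity, c, by simpa using h⟩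
  linarith

theorem inballDiam_le_simplexDiam (hd : 1 ≤ d) {s : Finset (Eu d)} (hs : s ∈ M.elements) :
    inballDiam s ≤ simplexDiam s := by
  refine csSup_le ?_ fun ρ ⟨hρ, c, h⟩ => le_simplexDiam hd hρ h
  obtain ⟨c, hc⟩ := nonempty_of_mem_elements hs
  exact ⟨0, le_rfl, c, by simpa using mem_simplexSet_of_mem hc⟩

theorem size_pos (hd : 1 ≤ d) : 0 < M.size := by
  obtain ⟨s, hs⟩ := M.nonempty_elements
  exact (inballDiam_pos hd hs).trans_le
    ((inballDiam_le_simplexDiam hd hs).trans (simplexDiam_le_size hs))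

theorem IsRegular.one_le (hd : 1 ≤ d) {σ : ℝ} (h : M.IsRegular σ) : 1 ≤ σ := by
  obtain ⟨s, hs⟩ := M.nonempty_elements
  have h1 := (h s hs).1
  have h2 := inballDiam_pos hd hs
  rw [div_le_iff₀ h2] at h1
  have := inballDiam_le_simplexDiam hd hs
  by_contra hσ
  push Not at hσ
  nlinarith

/-- `h ≤ σ h_T` and `h_T ≤ σ ρ_T`. The inball, rather than the diameter, controls the slope of the
barycentric coordinates. -/
theorem IsRegular.size_le (hd : 1 ≤ d) {σ : ℝ} (h : M.IsRegular σ) {s : Finset (Eu d)}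
    (hs : s ∈ M.elements) : M.size ≤ σ ^ 2 * inballDiam s := by
  obtain ⟨h1, h2⟩ := h s hs
  have h3 := inballDiam_pos hd hs
  rw [div_le_iff₀ h3] at h1
  have := h.one_le hd
  nlinarith

/-- A barycentric coordinate varies at rate at most the inverse of the inball diameter. -/
theorem coord_pos_of_dist_lt {s : Finset (Eu d)} {l : Eu d →ᵃ[ℝ] ℝ}
    (hl : ∀ y ∈ simplexSet s, l y ∈ Icc (0 : ℝ) 1) {x y : Eu d} (hx : l x = 1)
    (hxy : dist y x < inballDiam s) : 0 ≤ l y := by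
  obtain ⟨ρ, ⟨hρ, c, hc⟩, hlt⟩ : ∃ ρ ∈ {ρ : ℝ | 0 ≤ ρ ∧ ∃ c : Eu d,
      Metric.closedBall c (ρ / 2) ⊆ simplexSet s}, dist y x < ρ := by
    by_cases hne : {ρ : ℝ | 0 ≤ ρ ∧ ∃ c : Eu d,
      Metric.closedBall c (ρ / 2) ⊆ simplexSet s}.Nonempty
    · exact exists_lt_of_lt_csSup hne hxy
    -- The supremum of the empty set is `0` by convention, and no distance is smaller.
    · rw [inballDiam, not_nonempty_iff_eq_empty.1 hne, Real.sSup_empty] at hxy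
      exact absurd hxy (not_lt.2 dist_nonneg)
  have hadd : ∀ p v : Eu d, l (p + v) = l p + l.linear v := fun p v => by
    have := l.map_vadd p v
    simp only [vadd_eq_add] at this
    rw [add_comm p v, this, add_comm]
  by_cases hyx : y = x
  · rw [hyx, hx]; exact zero_le_one
  have hD : 0 < dist y x := dist_pos.2 hyx
  -- `v` has length `ρ/2` in the direction from `x` to `y`. Since `l` stays in `[0,1]` at `c ± v`,
  -- it loses at most `1/2` along `v`, hence at most `1` on the way from `x` to `y`.
  set v := (ρ / 2 / dist y x) • (y - x) with hv
  have hvn : ‖v‖ ≤ ρ / 2 := by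
    rw [hv, norm_smul, Real.norm_of_nonneg (by positivity), ← dist_eq_norm]
    exact (div_mul_cancel₀ _ hD.ne').le
  have h1 := hl (c + v) (hc (by simpa using hvn))
  have h2 := hl (c + -v) (hc (by simpa using hvn))
  rw [hadd] at h1 h2
  have h3 : l y = 1 + l.linear (y - x) := by rw [← hx, ← hadd]; congr 1; abel
  rw [map_neg] at h2
  have h4 : l.linear v = (ρ / 2 / dist y x) * l.linear (y - x) := by simp [hv]
  have h5 : ρ / 2 / dist y x ≥ 1 / 2 := by
    rw [ge_iff_le, le_div_iff₀ hD]; linarith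
  rw [h3]
  by_contra hcon
  push Not at hcon
  have h6 : l.linear (y - x) < -1 := by linarith
  have := h1.1; have := h2.2
  nlinarith

/-- The singleton of a node is itself a face, so conformity places `x` in the convex hull of `{x} ∩
s`, which must not be empty. -/
theorem mem_of_mem_nodes {x : Eu d} (hx : x ∈ M.nodes) {s : Finset (Eu d)}
    (hs : s ∈ M.elements) (hxs : x ∈ simplexSet s) : x ∈ s := by
  obtain ⟨t, ht, hxt⟩ := hx
  have h1 : ({x} : Finset (Eu d)) ∈ M.complex.faces :=
    M.complex.down_closed ht.1 (by simpa using hxt) (by simp)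
  have h2 := M.complex.inter_subset_convexHull h1 hs.1 ⟨by simp, hxs⟩
  by_contra hcon
  have : ((({x} : Finset (Eu d)) : Set (Eu d)) ∩ s) = ∅ := by
    simpa using hcon
  rw [this] at h2
  simp at h2

theorem affineMap_line (l : Eu d →ᵃ[ℝ] ℝ) (x y : Eu d) (t : ℝ) :
    l (x + t • (y - x)) = (1 - t) * l x + t * l y := by
  have h := l.apply_lineMap x y t
  rw [AffineMap.lineMap_apply, AffineMap.lineMap_apply] at h
  simp only [vsub_eq_sub, vadd_eq_add, smul_eq_mul] at h
  rw [add_comm x, h]; ring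

/-- Near a node only the elements having it as a vertex matter. -/
theorem eventually_mem_of_node {x : Eu d} (hx : x ∈ M.nodes) :
    ∀ᶠ y in 𝓝 x, ∀ s ∈ M.elements, y ∈ simplexSet s → x ∈ s := by
  rw [eventually_all_finite M.finite_elements]
  intro s hs
  by_cases h : x ∈ simplexSet s
  · exact Eventually.of_forall fun _ _ => mem_of_mem_nodes hx hs h
  · filter_upwards [(isCompact_simplexSet s).isClosed.isOpen_compl.mem_nhds h] with y hy hys
    exact absurd hys hy

/-- A neighborhood of `x` is covered by the elements with vertex `x`, and a strong contraction
towards `x` brings `y` into it. The same `t` works for all points near `y`, which is needed to prove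
openness of stars. -/
theorem exists_small_scale {x : Eu d} (hx : x ∈ M.nodes) (hxd : x ∈ M.domain) (y : Eu d) :
    ∃ t : ℝ, 0 < t ∧ t ≤ 1 ∧ ∀ᶠ y' in 𝓝 y, ∃ s ∈ M.elements, x ∈ s ∧
      x + t • (y' - x) ∈ simplexSet s := by
  have h1 : ∀ᶠ z in 𝓝 x, ∃ s ∈ M.elements, x ∈ s ∧ z ∈ simplexSet s := by
    filter_upwards [eventually_mem_of_node hx, isOpen_domain.mem_nhds hxd] with z hz hzd
    obtain ⟨s, hs, hzs⟩ := mem_carrier.1 (domain_subset_carrier hzd)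
    exact ⟨s, hs, hz s hs hzs, hzs⟩
  have hc : ContinuousAt (fun t : ℝ => x + t • (y - x)) 0 := by fun_prop
  have h2 : ∀ᶠ t in 𝓝 (0 : ℝ), ∀ᶠ z in 𝓝 (x + t • (y - x)),
      ∃ s ∈ M.elements, x ∈ s ∧ z ∈ simplexSet s := by
    have := hc.tendsto
    simp only [zero_smul, add_zero] at this
    exact this.eventually h1.eventually_nhds
  have h3 : ∀ᶠ t in 𝓝[>] (0 : ℝ), 0 < t ∧ t ≤ 1 := by
    filter_upwards [Ioo_mem_nhdsGT (zero_lt_one (α := ℝ))] with t ht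
    exact ⟨ht.1, ht.2.le⟩
  obtain ⟨t, ⟨ht0, ht1⟩, ht⟩ := (h3.and (nhdsWithin_le_nhds h2)).exists
  refine ⟨t, ht0, ht1, ?_⟩
  have hc' : ContinuousAt (fun y' : Eu d => x + t • (y' - x)) y := by fun_prop
  exact hc'.tendsto.eventually ht

/-- If a dilation of `y` towards the vertex `x` of an element lies in it, and the coordinate of
`y` for that vertex is nonnegative, then `y` lies in the element. -/
theorem mem_simplexSet_of_scale {s : Finset (Eu d)} {c : Eu d → (Eu d →ᵃ[ℝ] ℝ)}
    (hc : ∀ y, y ∈ simplexSet s ↔ ∀ z ∈ s, 0 ≤ c z y)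
    (hcc : ∀ z ∈ s, ∀ z' ∈ s, c z z' = if z = z' then 1 else 0) {x y : Eu d} (hx : x ∈ s)
    {t : ℝ} (ht : 0 < t) (hy : x + t • (y - x) ∈ simplexSet s) (hxy : 0 ≤ c x y) :
    y ∈ simplexSet s := by
  rw [hc]
  intro z hz
  by_cases hzx : z = x
  · rwa [hzx]
  -- The coordinate of `z ≠ x` vanishes at `x`, so the dilation only multiplies it by `t > 0`.
  have h := (hc _).1 hy z hz
  rw [affineMap_line, hcc z hz x hx, if_neg hzx, mul_zero, zero_add] at h
  exact nonneg_of_mul_nonneg_right h ht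

theorem coords_le_one {s : Finset (Eu d)} {c : Eu d → (Eu d →ᵃ[ℝ] ℝ)}
    (hc : ∀ y, y ∈ simplexSet s ↔ ∀ z ∈ s, 0 ≤ c z y) (h1 : ∀ y, ∑ z ∈ s, c z y = 1)
    {x : Eu d} (hx : x ∈ s) : ∀ y ∈ simplexSet s, c x y ∈ Icc (0 : ℝ) 1 := by
  intro y hy
  have := (hc y).1 hy
  exact ⟨this x hx, h1 y ▸ Finset.single_le_sum (f := fun z => c z y) this hx⟩

/-- A node in the domain is at distance at least `h / σ²` from the boundary of the domain. -/
theorem IsRegular.size_le_infDist (hd : 1 ≤ d) {σ : ℝ} (h : M.IsRegular σ) {x : Eu d}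
    (hx : x ∈ M.nodes) (hxd : x ∈ M.domain) :
    M.size ≤ σ ^ 2 * Metric.infDist x (frontier M.domain) := by
  have hσ := h.one_le hd
  -- The radius is at most the inball diameter of every element. Contracting `y` selects an element
  -- at `x`, and the coordinate of `x` in it is still nonnegative at `y`, so `y` itself lies in that
  -- element.
  have hball : Metric.ball x (M.size / σ ^ 2) ⊆ M.carrier := by
    intro y hy
    obtain ⟨t, ht0, -, ht⟩ := exists_small_scale hx hxd y
    obtain ⟨s, hs, hxs, hys⟩ := ht.self_of_nhds
    obtain ⟨c, hc, hc1, -, hcc⟩ := exists_coords hs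
    refine simplexSet_subset_carrier hs (mem_simplexSet_of_scale hc hcc hxs ht0 hys ?_)
    refine coord_pos_of_dist_lt (coords_le_one hc hc1 hxs) (by simp [hcc x hxs x hxs])
      (lt_of_lt_of_le (Metric.mem_ball.1 hy) ?_)
    rw [div_le_iff₀ (by positivity), mul_comm]
    exact h.size_le hd hs
  have hball' : Metric.ball x (M.size / σ ^ 2) ⊆ M.domain :=
    interior_maximal hball Metric.isOpen_ball
  have : M.size / σ ^ 2 ≤ Metric.infDist x (frontier M.domain) := by
    rw [Metric.le_infDist (nonempty_frontier_domain hd)]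
    intro y hy
    by_contra hcon
    push Not at hcon
    have := hball' (show y ∈ _ by rwa [Metric.mem_ball, dist_comm])
    rw [isOpen_domain.frontier_eq] at hy
    exact hy.2 this
  rwa [div_le_iff₀' (by positivity)] at this

/-- The open star of a node in the domain lies in the domain. -/
theorem mem_domain_of_coord_pos {x : Eu d} (hx : x ∈ M.nodes) (hxd : x ∈ M.domain)
    {s : Finset (Eu d)} (hs : s ∈ M.elements) (hxs : x ∈ s) {c : Eu d → (Eu d →ᵃ[ℝ] ℝ)}
    (hcc : ∀ z ∈ s, ∀ z' ∈ s, c z z' = if z = z' then 1 else 0) {p : Eu d}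
    (hp : p ∈ simplexSet s) (hpos : 0 < c x p) : p ∈ M.domain := by
  obtain ⟨t, ht0, ht1, ht⟩ := exists_small_scale hx hxd p
  have hpt : x + t • (p - x) ∈ simplexSet s := by
    have := (convex_convexHull ℝ (s : Set (Eu d))).add_smul_sub_mem
      (mem_simplexSet_of_mem hxs) hp ⟨ht0.le, ht1⟩
    exact this
  -- Only elements `s'` containing the contraction of `p` matter near `p`. The coordinates of `x` in
  -- `s` and `s'` agree at the vertices of the common face, hence at that contraction and at `p`; so
  -- the one in `s'` is positive near `p` too.
  have key : ∀ᶠ y in 𝓝 p, ∀ s' ∈ M.elements, x ∈ s' → x + t • (y - x) ∈ simplexSet s' →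
      y ∈ simplexSet s' := by
    rw [eventually_all_finite M.finite_elements]
    intro s' hs'
    by_cases hxs' : x ∈ s'
    swap
    · exact Eventually.of_forall fun _ h => absurd h hxs'
    by_cases hps' : x + t • (p - x) ∈ simplexSet s'
    swap
    · have hcont : ContinuousAt (fun y : Eu d => x + t • (y - x)) p := by fun_prop
      filter_upwards [hcont.tendsto.eventually
        ((isCompact_simplexSet s').isClosed.isOpen_compl.mem_nhds hps')] with y hy _ hys
      exact absurd hys hy
    obtain ⟨c', hc', -, -, hcc'⟩ := exists_coords hs'
    have hmem := M.complex.inter_subset_convexHull hs.1 hs'.1 ⟨hpt, hps'⟩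
    have hsub : convexHull ℝ ((s : Set (Eu d)) ∩ s') ⊆ {y | (c x - c' x) y = 0} := by
      refine convexHull_min (fun z hz => ?_) ?_
      · simp [hcc x hxs z hz.1, hcc' x hxs' z hz.2]
      · exact (convex_singleton (0 : ℝ)).affine_preimage (c x - c' x)
    have heq : c x (x + t • (p - x)) = c' x (x + t • (p - x)) := by
      have := hsub hmem
      simpa [sub_eq_zero] using this
    rw [affineMap_line, affineMap_line, hcc x hxs x hxs, hcc' x hxs' x hxs'] at heq
    have heq' : c x p = c' x p := mul_left_cancel₀ ht0.ne' (add_left_cancel heq)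
    have hcont : Continuous (c' x) := (c' x).continuous_of_finiteDimensional
    filter_upwards [hcont.continuousAt.eventually (lt_mem_nhds (heq' ▸ hpos))] with y hy _ hys
    exact mem_simplexSet_of_scale hc' hcc' hxs' ht0 hys hy.le
  refine mem_interior_iff_mem_nhds.2 ?_
  filter_upwards [key, ht] with y hy hty
  obtain ⟨s', hs', hxs', hys'⟩ := hty
  exact simplexSet_subset_carrier hs' (hy s' hs' hxs' hys')

/-- Every point of the boundary of the domain is within `h` of a node on that boundary. -/
theorem exists_node_of_mem_frontier {p : Eu d} (hp : p ∈ frontier M.domain) :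
    ∃ z ∈ M.nodes, z ∈ frontier M.domain ∧ dist p z ≤ M.size := by
  rw [isOpen_domain.frontier_eq] at hp
  obtain ⟨s, hs, hps⟩ := mem_carrier.1 (closure_domain_subset_carrier hp.1)
  obtain ⟨c, hc, hc1, -, hcc⟩ := exists_coords hs
  -- A vertex with positive coordinate at `p` cannot lie in the domain, because its open star would
  -- put `p` there.
  obtain ⟨z, hz, hzp⟩ : ∃ z ∈ s, 0 < c z p := by
    by_contra! hcon
    have := hc1 p
    linarith [Finset.sum_nonpos hcon]
  refine ⟨z, ⟨s, hs, hz⟩, ?_, dist_le_size hs hps (mem_simplexSet_of_mem hz)⟩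
  rw [isOpen_domain.frontier_eq]
  exact ⟨carrier_subset_closure_domain (nodes_subset_carrier ⟨s, hs, hz⟩), fun hzd =>
    hp.2 (mem_domain_of_coord_pos ⟨s, hs, hz⟩ hzd hs hz hcc hps hzp)⟩

/-! ### Fitted meshes -/

/-- A linear functional is maximal over the mesh at a node, and a nonzero one has no local maximum
at an interior point. -/
theorem exists_maximal_node_mem_frontier (l : StrongDual ℝ (Eu d)) (hl : l ≠ 0) :
    ∃ z ∈ M.nodes, z ∈ frontier M.domain ∧ ∀ y ∈ M.nodes, l y ≤ l z := by
  obtain ⟨z, hz, hmax⟩ := M.finite_nodes.exists_maximalFor l _ M.nonempty_nodes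
  have hmax' : ∀ y ∈ M.nodes, l y ≤ l z := fun y hy =>
    (le_total (l y) (l z)).elim id fun h => hmax hy h
  refine ⟨z, hz, ?_, hmax'⟩
  have hcarrier : ∀ y ∈ M.carrier, l y ≤ l z := by
    intro y hy
    obtain ⟨s, hs, hys⟩ := mem_carrier.1 hy
    have : simplexSet s ⊆ {y | l y ≤ l z} :=
      convexHull_min (fun w hw => hmax' w ⟨s, hs, hw⟩)
        (convex_halfSpace_le l.toLinearMap.isLinear _)
    exact this hys
  rw [isOpen_domain.frontier_eq]
  refine ⟨carrier_subset_closure_domain (nodes_subset_carrier hz), fun hzd => hl ?_⟩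
  have hmaxon : IsLocalMax l z := by
    filter_upwards [isOpen_domain.mem_nhds hzd] with y hy
    exact hcarrier y (domain_subset_carrier hy)
  have := hmaxon.fderiv_eq_zero
  simpa using this

/-- A functional strictly separating a node from the closure of `Ω` would be maximal at a node on
the boundary of `Ω_h`, which lies on the boundary of `Ω`. -/
theorem IsFitted.nodes_subset (hd : 1 ≤ d) {Ω : Set (Eu d)} (hΩ : Convex ℝ Ω)
    (h : M.IsFitted Ω) : M.nodes ⊆ closure Ω := by
  have := nontrivial_eu hd
  have hne : (closure Ω).Nonempty := by
    obtain ⟨v, hv⟩ := exists_ne (0 : Eu d)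
    obtain ⟨z, hz, hzf, -⟩ := M.exists_maximal_node_mem_frontier (innerSL ℝ v) (by
      intro h0
      have : innerSL ℝ v v = 0 := by rw [h0]; rfl
      simp [hv] at this)
    exact ⟨z, frontier_subset_closure (h z hz hzf)⟩
  intro y hy
  by_contra hcon
  obtain ⟨l, a, hl, hla⟩ := geometric_hahn_banach_closed_point hΩ.closure isClosed_closure hcon
  have hl0 : l ≠ 0 := by
    rintro rfl
    obtain ⟨w, hw⟩ := hne
    have := hl w hw
    simp at this hla
    linarith
  obtain ⟨z, hz, hzf, hmax⟩ := M.exists_maximal_node_mem_frontier l hl0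
  have h1 := hl z (frontier_subset_closure (h z hz hzf))
  have h2 := hmax y hy
  linarith

theorem IsFitted.carrier_subset (hd : 1 ≤ d) {Ω : Set (Eu d)} (hΩ : Convex ℝ Ω)
    (h : M.IsFitted Ω) : M.carrier ⊆ closure Ω := by
  intro y hy
  obtain ⟨s, hs, hys⟩ := mem_carrier.1 hy
  exact convexHull_min (fun w hw => h.nodes_subset hd hΩ ⟨s, hs, hw⟩) hΩ.closure hys

theorem IsFitted.mem_of_interior (hd : 1 ≤ d) {Ω : Set (Eu d)} (hΩ : Convex ℝ Ω)
    (hΩo : IsOpen Ω) (h : M.IsFitted Ω) {x : Eu d} (hx : x ∈ M.interiorNodes Ω) :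
    x ∈ Ω ∧ x ∈ M.domain := by
  have hxf : x ∉ frontier Ω := fun hf => hx.2 ⟨hx.1, hf⟩
  constructor
  · by_contra hcon
    exact hxf (hΩo.frontier_eq ▸ ⟨h.nodes_subset hd hΩ hx.1, hcon⟩)
  · by_contra hcon
    exact hxf (h x hx.1 (isOpen_domain.frontier_eq ▸
      ⟨carrier_subset_closure_domain (nodes_subset_carrier hx.1), hcon⟩))

/-- The distances of a point to the boundaries of `Ω` and of `Ω_h` differ by at most `h`. -/
theorem IsFitted.infDist_compl_le (hd : 1 ≤ d) {Ω : Set (Eu d)} (hΩo : IsOpen Ω)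
    (h : M.IsFitted Ω) (x : Eu d) :
    Metric.infDist x Ωᶜ ≤ Metric.infDist x (frontier M.domain) + M.size := by
  obtain ⟨p, hp, hpx⟩ := isClosed_frontier.exists_infDist_eq_dist
    (nonempty_frontier_domain (M := M) hd) x
  obtain ⟨z, hz, hzf, hpz⟩ := M.exists_node_of_mem_frontier hp
  have hzΩ : z ∈ Ωᶜ := by
    have := h z hz hzf
    rw [hΩo.frontier_eq] at this
    exact this.2
  have := Metric.infDist_le_dist_of_mem (x := x) hzΩ
  rw [hpx]
  linarith [dist_triangle x p z]

end Mesh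

/-! ### Bounds on compact sets, and affine functions. -/

theorem exists_pos_forall_le_of_isCompact {X : Type*} [TopologicalSpace X] {K : Set X}
    (hK : IsCompact K) {F : X → ℝ} (hF : ContinuousOn F K) (hpos : ∀ y ∈ K, 0 < F y) :
    ∃ c > 0, ∀ y ∈ K, c ≤ F y := by
  rcases K.eq_empty_or_nonempty with rfl | hne
  · exact ⟨1, one_pos, by simp⟩
  · obtain ⟨x, hx, hmin⟩ := hK.exists_isMinOn hne hF
    exact ⟨F x, hpos x hx, fun y hy => hmin hy⟩

theorem exists_pos_forall_abs_le_of_isCompact {X : Type*} [TopologicalSpace X] {K : Set X}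
    (hK : IsCompact K) {F : X → ℝ} (hF : ContinuousOn F K) :
    ∃ B > 0, ∀ y ∈ K, |F y| ≤ B := by
  obtain ⟨B, hB⟩ := hK.exists_bound_of_continuousOn hF
  exact ⟨max B 1, by positivity, fun y hy => (hB y hy).trans (le_max_left _ _)⟩

section

variable {d : ℕ}

/-- The affine function `y ↦ g y + a`. -/
noncomputable def affineOf (g : StrongDual ℝ (Eu d)) (a : ℝ) : Eu d →ᵃ[ℝ] ℝ :=
  g.toLinearMap.toAffineMap + AffineMap.const ℝ (Eu d) a

@[simp]
theorem affineOf_apply (g : StrongDual ℝ (Eu d)) (a : ℝ) (y : Eu d) :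
    affineOf g a y = g y + a := by
  simp [affineOf]

theorem continuous_affineMap (l : Eu d →ᵃ[ℝ] ℝ) : Continuous l :=
  l.continuous_of_finiteDimensional

theorem contDiff_affineMap {n : WithTop ℕ∞} (l : Eu d →ᵃ[ℝ] ℝ) : ContDiff ℝ n l := by
  have : (l : Eu d → ℝ) = fun y => l.linear.toContinuousLinearMap y + l 0 := by
    ext y
    exact congrFun (l.decomp) y
  rw [this]
  fun_prop

theorem affineMap_add (l : Eu d →ᵃ[ℝ] ℝ) (x v : Eu d) : l (x + v) = l x + l.linear v := by
  have := l.map_vadd x v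
  simp only [vadd_eq_add] at this
  rw [add_comm x v, this, add_comm]

theorem affineMap_combo (l : Eu d →ᵃ[ℝ] ℝ) {a b : ℝ} (hab : a + b = 1) (x y : Eu d) :
    l (a • x + b • y) = a * l x + b * l y := by
  have h : a • x + b • y = y + a • (x - y) := by
    obtain rfl : b = 1 - a := by linarith
    module
  have h' : l x = l y + l.linear (x - y) := by rw [← affineMap_add]; congr 1; abel
  rw [h, affineMap_add, map_smul, h', smul_eq_mul]
  obtain rfl : b = 1 - a := by linarith
  ring

theorem affineMap_sum (l : Eu d →ᵃ[ℝ] ℝ) {s : Finset (Eu d)} {c : Eu d → ℝ}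
    (h1 : ∑ z ∈ s, c z = 1) : l (∑ z ∈ s, c z • z) = ∑ z ∈ s, c z * l z := by
  have h : ∀ y, l y = l 0 + l.linear y := fun y => by rw [← affineMap_add, zero_add]
  rw [h, map_sum]
  have : ∀ z ∈ s, c z * l z = c z * l 0 + c z * l.linear z := fun z _ => by rw [h z]; ring
  rw [Finset.sum_congr rfl this, Finset.sum_add_distrib, ← Finset.sum_mul, h1, one_mul]
  simp

/-! ### Second derivatives of test functions -/

/-- Every test function below is quadratic along some line, so the needed entry of its Hessian can
be read off there. -/
theorem iteratedFDeriv_two_of_quadratic {φ : Eu d → ℝ} (hφ : ContDiff ℝ 2 φ) {p v : Eu d}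
    {a b c : ℝ} (h : ∀ τ : ℝ, φ (p + τ • v) = a + b * τ + c * τ ^ 2) :
    iteratedFDeriv ℝ 2 φ p ![v, v] = 2 * c := by
  rw [iteratedFDeriv_two_apply]
  simp only [Matrix.cons_val_zero, Matrix.cons_val_one]
  have hline : ∀ τ : ℝ, HasDerivAt (fun τ : ℝ => p + τ • v) v τ := fun τ => by
    simpa using ((hasDerivAt_id τ).smul_const v).const_add p
  have h1 : ∀ τ : ℝ, fderiv ℝ φ (p + τ • v) v = b + 2 * c * τ := fun τ => by
    have hd := ((hφ.differentiable (by norm_num)) (p + τ • v)).hasFDerivAt.comp_hasDerivAt τ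
      (hline τ)
    have hd' : HasDerivAt (fun τ : ℝ => a + b * τ + c * τ ^ 2) (b + 2 * c * τ) τ := by
      have := (((hasDerivAt_id τ).const_mul b).const_add a).add
        (((hasDerivAt_id τ).pow 2).const_mul c)
      convert! this using 1
      simp; ring
    have he : (φ ∘ fun τ : ℝ => p + τ • v) = fun τ : ℝ => a + b * τ + c * τ ^ 2 := funext h
    rw [he] at hd
    exact hd.unique hd'
  have hf : Differentiable ℝ (fderiv ℝ φ) :=
    (hφ.fderiv_right (m := 1) (by norm_num)).differentiable (by norm_num)
  have hd := (hf (p + (0 : ℝ) • v)).hasFDerivAt.comp_hasDerivAt 0 (hline 0)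
  have hd2 : HasDerivAt (fun τ : ℝ => fderiv ℝ φ (p + τ • v) v)
      (fderiv ℝ (fderiv ℝ φ) (p + (0 : ℝ) • v) v v) 0 :=
    ((ContinuousLinearMap.apply ℝ ℝ v).hasFDerivAt.comp_hasDerivAt 0 hd)
  have hd' : HasDerivAt (fun τ : ℝ => b + 2 * c * τ) (2 * c) 0 := by
    simpa using ((hasDerivAt_id (0 : ℝ)).const_mul (2 * c)).const_add b
  rw [funext h1] at hd2
  have := hd2.unique hd'
  simpa using this

theorem lambdaOne_le {φ : Eu d → ℝ} {x v : Eu d} (hv : ‖v‖ = 1) :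
    lambdaOne φ x ≤ iteratedFDeriv ℝ 2 φ x ![v, v] := by
  refine csInf_le ⟨-‖iteratedFDeriv ℝ 2 φ x‖, ?_⟩ ⟨v, hv, rfl⟩
  rintro _ ⟨w, hw, rfl⟩
  have := (iteratedFDeriv ℝ 2 φ x).le_opNorm ![w, w]
  simp only [Fin.prod_univ_two, Matrix.cons_val_zero, Matrix.cons_val_one, hw, mul_one] at this
  exact (abs_le.1 this).1

/-! ### Viscosity solutions -/

variable {Ω : Set (Eu d)} {f u : Eu d → ℝ}

/-- If `f < u` at `z`, hence nearby, a steep paraboloid touches `u` from above at a point near `z`,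
where the subsolution property forces `u ≤ f`. -/
theorem IsViscositySolution.le_obstacle (hΩo : IsOpen Ω) (hΩb : Bornology.IsBounded Ω)
    (hf : ContinuousOn f (closure Ω)) (h : IsViscositySolution Ω f u) :
    ∀ x ∈ closure Ω, u x ≤ f x := by
  intro z hz
  by_cases hzΩ : z ∈ Ω
  swap
  · exact (h.boundary z (hΩo.frontier_eq ▸ ⟨hz, hzΩ⟩)).le
  by_contra! hlt
  have hK : IsCompact (closure Ω) := hΩb.isCompact_closure
  obtain ⟨B, hB0, hB⟩ := exists_pos_forall_abs_le_of_isCompact hK h.continuousOn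
  have hcl : closure Ω ∈ 𝓝 z := mem_of_superset (hΩo.mem_nhds hzΩ) subset_closure
  have hev : ∀ᶠ y in 𝓝 z, f y < u y ∧ y ∈ Ω :=
    ((hf.continuousAt hcl).eventually_lt (h.continuousOn.continuousAt hcl) hlt).and
      (hΩo.mem_nhds hzΩ)
  obtain ⟨r, hr, hball⟩ := Metric.nhds_basis_closedBall.mem_iff.1 hev
  -- The paraboloid reaches `3B` on the sphere of radius `r`, more than the oscillation `2B` of `u`,
  -- so the maximum is interior.
  set N := 3 * B / r ^ 2 with hN
  set φ : Eu d → ℝ := fun p => N * ‖p - z‖ ^ 2 with hφ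
  have hsub : Metric.closedBall z r ⊆ closure Ω := fun y hy => subset_closure (hball hy).2
  have hφs : ContDiff ℝ 2 φ := by
    exact contDiff_const.mul ((contDiff_id.sub contDiff_const).norm_sq ℝ)
  obtain ⟨p, hp, hmax⟩ := (isCompact_closedBall z r).exists_isMaxOn
    ⟨z, Metric.mem_closedBall_self hr.le⟩
    ((h.continuousOn.mono hsub).sub hφs.continuous.continuousOn)
  have hpz : u z ≤ u p - φ p := by
    have : u z - φ z ≤ u p - φ p := hmax (Metric.mem_closedBall_self hr.le)
    simpa [hφ] using this
  have hpr : dist p z < r := by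
    refine lt_of_le_of_ne (Metric.mem_closedBall.1 hp) fun he => ?_
    have : φ p = 3 * B := by
      simp only [hφ, hN]
      rw [← dist_eq_norm, he]
      field_simp
    have h1 := abs_le.1 (hB z hz)
    have h2 := abs_le.1 (hB p (hsub hp))
    linarith [h1.1, h2.2]
  have hloc : IsLocalMax (fun y => u y - φ y) p := by
    filter_upwards [Metric.isOpen_ball.mem_nhds (Metric.mem_ball.2 hpr)] with y hy
    exact hmax (Metric.ball_subset_closedBall hy)
  have h1 := h.subsolution p (hball hp).2 φ hφs.contDiffOn hloc
  have h2 := h1.trans (min_le_left _ _)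
  linarith [(hball hp).1]

/-- If `u` exceeds its chord at `z` by `m`, the chord plus a small concave parabola along the
segment and a steep transversal paraboloid touches `u` from above inside a thin tube. Its second
derivative along the segment is negative, against `λ₁ ≥ 0`. -/
theorem IsViscositySolution.convex_aux (hΩo : IsOpen Ω) (hΩb : Bornology.IsBounded Ω)
    (hΩc : Convex ℝ Ω) (h : IsViscositySolution Ω f u) {x y : Eu d} (hx : x ∈ Ω) (hy : y ∈ Ω)
    (hxy : x ≠ y) {b : ℝ} (hb0 : 0 ≤ b) (hb1 : b ≤ 1) :
    u (x + b • (y - x)) ≤ u x + b * (u y - u x) := by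
  by_contra! hlt
  set z := x + b • (y - x) with hz
  set m := u z - (u x + b * (u y - u x)) with hm
  have hm0 : 0 < m := by linarith
  have hK : IsCompact (closure Ω) := hΩb.isCompact_closure
  obtain ⟨B, hB0, hB⟩ := exists_pos_forall_abs_le_of_isCompact hK h.continuousOn
  have hcont : ∀ p ∈ Ω, ContinuousAt u p := fun p hp =>
    h.continuousOn.continuousAt (mem_of_superset (hΩo.mem_nhds hp) subset_closure)
  set e := y - x with he
  have he0 : 0 < ‖e‖ := norm_pos_iff.2 (sub_ne_zero.2 hxy.symm)
  -- `s` is the coordinate along the segment, from `0` at `x` to `1` at `y`; `P` is the squared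
  -- distance to the line.
  set s : Eu d → ℝ := fun p => inner ℝ (p - x) e / ‖e‖ ^ 2 with hs
  set P : Eu d → ℝ := fun p => ‖p - x‖ ^ 2 - s p ^ 2 * ‖e‖ ^ 2 with hP
  have hPe : ∀ p, ‖p - (x + s p • e)‖ ^ 2 = P p := fun p => by
    have h1 : p - (x + s p • e) = (p - x) - s p • e := by abel
    have h2 : inner ℝ (p - x) e = s p * ‖e‖ ^ 2 := by simp only [hs]; field_simp
    rw [h1, norm_sub_sq_real, inner_smul_right, h2, norm_smul, mul_pow, Real.norm_eq_abs,
      sq_abs]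
    simp only [hP]; ring
  have hss : ContDiff ℝ 2 s := by
    simp only [hs]
    exact ((contDiff_id.sub contDiff_const).inner ℝ contDiff_const).div_const _
  have hPs : ContDiff ℝ 2 P :=
    ((contDiff_id.sub contDiff_const).norm_sq ℝ).sub ((hss.pow 2).mul contDiff_const)
  -- the radius of the tube
  have hseg : segment ℝ x y ⊆ Ω := hΩc.segment_subset hx hy
  have hsegc : IsCompact (segment ℝ x y) := by
    rw [segment_eq_image]
    exact isCompact_Icc.image (by fun_prop)
  obtain ⟨r1, hr1, hth⟩ := hsegc.exists_cthickening_subset_open hΩo hseg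
  have hux : ∀ᶠ p in 𝓝 x, u p - u x < m / 2 := by
    have : ContinuousAt (fun p => u p - u x) x := (hcont x hx).sub continuousAt_const
    exact this.eventually_lt_const (by simpa using hm0)
  have huy : ∀ᶠ p in 𝓝 y, u p - u y < m / 2 := by
    have : ContinuousAt (fun p => u p - u y) y := (hcont y hy).sub continuousAt_const
    exact this.eventually_lt_const (by simpa using hm0)
  obtain ⟨r2, hr2, hux⟩ := Metric.nhds_basis_closedBall.mem_iff.1 hux
  obtain ⟨r3, hr3, huy⟩ := Metric.nhds_basis_closedBall.mem_iff.1 huy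
  set r := min r1 (min r2 r3) with hr
  have hr0 : 0 < r := by positivity
  -- On the lateral boundary of the tube the penalty is `2B`, so `u - φ ≤ 0` there; at the two ends
  -- `u - φ < m / 2`, as `r` is below the moduli of continuity of `u` there. At `z` the value is at
  -- least `m / 2`.
  set N := 2 * B / r ^ 2 with hN
  have hN0 : 0 ≤ N := by positivity
  set φ : Eu d → ℝ := fun p => u x + s p * (u y - u x) + m / 2 * (s p * (1 - s p)) + N * P p
    with hφ
  have hφs : ContDiff ℝ 2 φ :=
    (((contDiff_const.add (hss.mul contDiff_const)).add
      (contDiff_const.mul (hss.mul (contDiff_const.sub hss)))).add (contDiff_const.mul hPs))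
  set K : Set (Eu d) := {p | (0 ≤ s p ∧ s p ≤ 1) ∧ P p ≤ r ^ 2} with hKdef
  have hdist : ∀ p ∈ K, dist p (x + s p • e) ≤ r := fun p hp => by
    rw [dist_eq_norm]
    exact abs_le_of_sq_le_sq' ((hPe p).le.trans hp.2) hr0.le |>.2
  have hKΩ : K ⊆ Ω := fun p hp => by
    refine hth (Metric.mem_cthickening_of_dist_le p (x + s p • e) r1 _ ?_
      ((hdist p hp).trans (min_le_left _ _)))
    rw [segment_eq_image']
    exact ⟨s p, hp.1, rfl⟩
  have hKclosed : IsClosed K :=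
    ((isClosed_le continuous_const hss.continuous).inter
      (isClosed_le hss.continuous continuous_const)).inter
      (isClosed_le hPs.continuous continuous_const)
  have hKc : IsCompact K :=
    hK.of_isClosed_subset hKclosed (hKΩ.trans subset_closure)
  have hsz : s z = b := by
    have : z - x = b • e := by simp [hz]
    simp only [hs]
    rw [this, inner_smul_left, real_inner_self_eq_norm_sq]
    simp [he0.ne']
  have hPz : P z = 0 := by rw [← hPe, hsz]; simp [hz]
  have hzK : z ∈ K := ⟨by rw [hsz]; exact ⟨hb0, hb1⟩, by rw [hPz]; positivity⟩
  have hφz : m / 2 ≤ u z - φ z := by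
    simp only [hφ]
    rw [hsz, hPz]
    nlinarith [mul_nonneg hm0.le (sq_nonneg b), mul_nonneg hm0.le (mul_nonneg hb0 hb0),
      mul_nonneg hm0.le (sub_nonneg.2 hb1)]
  obtain ⟨p, hp, hmax⟩ := hKc.exists_isMaxOn ⟨z, hzK⟩
    ((h.continuousOn.mono (hKΩ.trans subset_closure)).sub hφs.continuous.continuousOn)
  have hgp : m / 2 ≤ u p - φ p := hφz.trans (hmax hzK)
  have hP0 : 0 ≤ P p := (hPe p) ▸ sq_nonneg _
  have hd := hdist p hp
  have hs0 : 0 < s p := by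
    refine lt_of_le_of_ne hp.1.1 fun h0 => ?_
    rw [← h0, zero_smul, add_zero] at hd
    have h1 : u p - u x < m / 2 :=
      hux (Metric.mem_closedBall.2 (hd.trans ((min_le_right _ _).trans (min_le_left _ _))))
    simp only [hφ] at hgp
    rw [← h0] at hgp
    nlinarith [mul_nonneg hN0 hP0]
  have hs1 : s p < 1 := by
    refine lt_of_le_of_ne hp.1.2 fun h0 => ?_
    rw [h0, one_smul, he, add_sub_cancel] at hd
    have h1 : u p - u y < m / 2 :=
      huy (Metric.mem_closedBall.2 (hd.trans ((min_le_right _ _).trans (min_le_right _ _))))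
    simp only [hφ] at hgp
    rw [h0] at hgp
    nlinarith [mul_nonneg hN0 hP0]
  have hP1 : P p < r ^ 2 := by
    refine lt_of_le_of_ne hp.2 fun h0 => ?_
    have h1 : N * P p = 2 * B := by rw [h0, hN]; field_simp
    simp only [hφ] at hgp
    rw [h1] at hgp
    have hux' := abs_le.1 (hB x (subset_closure hx))
    have huy' := abs_le.1 (hB y (subset_closure hy))
    have hup := abs_le.1 (hB p (subset_closure (hKΩ hp)))
    nlinarith [mul_nonneg hs0.le (sub_nonneg.2 hs1.le),
      mul_nonneg hm0.le (mul_nonneg hs0.le (sub_nonneg.2 hs1.le)),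
      mul_nonneg hs0.le (neg_le_iff_add_nonneg.1 huy'.1),
      mul_nonneg (sub_nonneg.2 hs1.le) (neg_le_iff_add_nonneg.1 hux'.1)]
  have hloc : IsLocalMax (fun q => u q - φ q) p := by
    filter_upwards [hss.continuous.continuousAt.eventually (lt_mem_nhds hs0),
      hss.continuous.continuousAt.eventually (gt_mem_nhds hs1),
      hPs.continuous.continuousAt.eventually (gt_mem_nhds hP1)] with q h1 h2 h3
    exact hmax ⟨⟨h1.le, h2.le⟩, h3.le⟩
  have hsub := (h.subsolution p (hKΩ hp) φ hφs.contDiffOn hloc).trans (min_le_right _ _)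
  set v := ‖e‖⁻¹ • e with hv
  have hvn : ‖v‖ = 1 := by rw [hv, norm_smul, norm_inv, norm_norm, inv_mul_cancel₀ he0.ne']
  have hsτ : ∀ τ : ℝ, s (p + τ • v) = s p + τ * ‖e‖⁻¹ := fun τ => by
    have : p + τ • v - x = (p - x) + (τ * ‖e‖⁻¹) • e := by rw [hv, smul_smul]; abel
    simp only [hs]
    rw [this, inner_add_left, inner_smul_left, real_inner_self_eq_norm_sq]
    simp only [conj_trivial]
    field_simp
  have hPτ : ∀ τ : ℝ, P (p + τ • v) = P p := fun τ => by
    rw [← hPe, ← hPe, hsτ]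
    congr 2
    rw [hv, add_smul, smul_smul]
    abel
  have hquad := iteratedFDeriv_two_of_quadratic hφs (p := p) (v := v) (a := φ p)
    (b := ‖e‖⁻¹ * (u y - u x) + m / 2 * ‖e‖⁻¹ * (1 - 2 * s p)) (c := -(m / 2 * ‖e‖⁻¹ ^ 2))
    (fun τ => by
      simp only [hφ]
      rw [hsτ, hPτ]
      ring)
  have := hsub.trans (lambdaOne_le hvn)
  rw [hquad] at this
  have : 0 < m / 2 * ‖e‖⁻¹ ^ 2 := by positivity
  linarith

theorem IsViscositySolution.convexOn (hΩo : IsOpen Ω) (hΩb : Bornology.IsBounded Ω)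
    (hΩc : Convex ℝ Ω) (h : IsViscositySolution Ω f u) : ConvexOn ℝ (closure Ω) u := by
  refine ⟨hΩc.closure, fun x hx y hy a b ha hb hab => ?_⟩
  have key : ∀ q ∈ Ω ×ˢ Ω, u (a • q.1 + b • q.2) ≤ a • u q.1 + b • u q.2 := by
    rintro ⟨x, y⟩ ⟨hx, hy⟩
    obtain rfl : a = 1 - b := by linarith
    by_cases hxy : x = y
    · subst hxy
      simp only [← add_smul]
      simp
    have := h.convex_aux hΩo hΩb hΩc hx hy hxy hb (by linarith)
    have h1 : (1 - b) • x + b • y = x + b • (y - x) := by module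
    simp only [smul_eq_mul, h1]
    linarith
  have hmem : ((x, y) : Eu d × Eu d) ∈ closure (Ω ×ˢ Ω) := by
    rw [closure_prod_eq]; exact ⟨hx, hy⟩
  have h1 : ContinuousWithinAt (fun q : Eu d × Eu d => u q.1) (Ω ×ˢ Ω) (x, y) :=
    ((h.continuousOn x hx).mono subset_closure).comp continuousWithinAt_fst fun q hq => hq.1
  have h2 : ContinuousWithinAt (fun q : Eu d × Eu d => u q.2) (Ω ×ˢ Ω) (x, y) :=
    ((h.continuousOn y hy).mono subset_closure).comp continuousWithinAt_snd fun q hq => hq.2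
  have h3 : ContinuousWithinAt (fun q : Eu d × Eu d => u (a • q.1 + b • q.2)) (Ω ×ˢ Ω) (x, y) :=
    ContinuousWithinAt.comp (t := Ω) (f := fun q : Eu d × Eu d => a • q.1 + b • q.2)
      ((h.continuousOn _ (hΩc.closure hx hy ha hb hab)).mono subset_closure)
      (by fun_prop) fun q hq => hΩc hq.1 hq.2 ha hb hab
  exact ContinuousWithinAt.closure_le hmem h3 ((h1.const_smul a).add (h2.const_smul b)) key

/-- A strictly convex quadratic function below the obstacle is below the viscosity solution at
its center. -/
theorem IsViscositySolution.le_of_quadratic_le (hd : 1 ≤ d) (hΩo : IsOpen Ω)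
    (hΩb : Bornology.IsBounded Ω) (h : IsViscositySolution Ω f u) {x : Eu d} (hx : x ∈ Ω)
    (l : Eu d →ᵃ[ℝ] ℝ) {η : ℝ} (hη : 0 < η)
    (hl : ∀ y ∈ closure Ω, l y + η * ‖y - x‖ ^ 2 ≤ f y) : l x ≤ u x := by
  by_contra! hlt
  set φ : Eu d → ℝ := fun y => l y + η * ‖y - x‖ ^ 2 with hφ
  have hφs : ContDiff ℝ 2 φ := (contDiff_affineMap l).add
    (contDiff_const.mul ((contDiff_id.sub contDiff_const).norm_sq ℝ))
  -- At the minimum `u < φ ≤ f`. This excludes the boundary, where `u = f`, and in the interior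
  -- contradicts the supersolution property, since the Hessian of `φ` is `2η` times the identity.
  obtain ⟨p, hp, hmin⟩ := hΩb.isCompact_closure.exists_isMinOn ⟨x, subset_closure hx⟩
    (h.continuousOn.sub hφs.continuous.continuousOn)
  have h1 : u p - φ p < 0 := by
    have : u p - φ p ≤ u x - φ x := hmin (subset_closure hx)
    have h2 : φ x = l x := by simp [hφ]
    linarith
  have h2 : φ p ≤ f p := hl p hp
  have hpΩ : p ∈ Ω := by
    by_contra hcon
    have := h.boundary p (hΩo.frontier_eq ▸ ⟨hp, hcon⟩)
    linarith
  have hloc : IsLocalMin (fun y => u y - φ y) p := by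
    filter_upwards [hΩo.mem_nhds hpΩ] with y hy
    exact hmin (subset_closure hy)
  have h3 := h.supersolution p hpΩ φ hφs.contDiffOn hloc
  have h4 : 2 * η ≤ lambdaOne φ p := by
    obtain ⟨v, hv⟩ := exists_norm_eq_one hd
    refine le_csInf ⟨_, v, hv, rfl⟩ ?_
    rintro _ ⟨w, hw, rfl⟩
    refine (iteratedFDeriv_two_of_quadratic hφs (a := φ p)
      (b := l.linear w + 2 * η * inner ℝ (p - x) w) (c := η) fun τ => ?_).ge
    have : p + τ • w - x = (p - x) + τ • w := by abel
    simp only [hφ]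
    rw [affineMap_add, this, norm_add_sq_real, norm_smul, hw, inner_smul_right, map_smul,
      smul_eq_mul, mul_one, Real.norm_eq_abs, sq_abs]
    ring
  rcases min_le_iff.1 h3 with h5 | h5 <;> linarith

/-! ### The convex envelope -/

theorem exists_affine_le (hΩb : Bornology.IsBounded Ω) (hf : ContinuousOn f (closure Ω)) :
    ∃ l : Eu d →ᵃ[ℝ] ℝ, ∀ y ∈ closure Ω, l y ≤ f y := by
  obtain ⟨B, -, hB⟩ := exists_pos_forall_abs_le_of_isCompact hΩb.isCompact_closure hf
  refine ⟨AffineMap.const ℝ _ (-B), fun y hy => ?_⟩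
  simpa using (abs_le.1 (hB y hy)).1

theorem affine_le_convexEnvelope {l : Eu d →ᵃ[ℝ] ℝ} (hl : ∀ y ∈ closure Ω, l y ≤ f y)
    {x : Eu d} (hx : x ∈ closure Ω) : l x ≤ convexEnvelope Ω f x :=
  le_csSup ⟨f x, by rintro _ ⟨l', hl', rfl⟩; exact hl' x hx⟩ ⟨l, hl, rfl⟩

theorem convexEnvelope_le (hΩb : Bornology.IsBounded Ω) (hf : ContinuousOn f (closure Ω))
    {x : Eu d} {a : ℝ} (h : ∀ l : Eu d →ᵃ[ℝ] ℝ, (∀ y ∈ closure Ω, l y ≤ f y) → l x ≤ a) :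
    convexEnvelope Ω f x ≤ a := by
  obtain ⟨l, hl⟩ := exists_affine_le hΩb hf
  exact csSup_le ⟨_, l, hl, rfl⟩ (by rintro _ ⟨l', hl', rfl⟩; exact h l' hl')

theorem convexOn_convexEnvelope (hΩb : Bornology.IsBounded Ω) (hΩc : Convex ℝ Ω)
    (hf : ContinuousOn f (closure Ω)) : ConvexOn ℝ (closure Ω) (convexEnvelope Ω f) := by
  refine ⟨hΩc.closure, fun x hx y hy a b ha hb hab => convexEnvelope_le hΩb hf fun l hl => ?_⟩
  rw [affineMap_combo l hab]
  exact add_le_add (mul_le_mul_of_nonneg_left (affine_le_convexEnvelope hl hx) ha)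
    (mul_le_mul_of_nonneg_left (affine_le_convexEnvelope hl hy) hb)

/-- On the boundary of a strictly convex set there are strictly supporting functionals. -/
theorem exists_strict_support (hΩo : IsOpen Ω) (hΩc : Convex ℝ Ω)
    (hΩs : StrictConvex ℝ (closure Ω)) {x : Eu d} (hx : x ∈ frontier Ω) :
    ∃ g : StrongDual ℝ (Eu d), ∀ y ∈ closure Ω, y ≠ x → g y < g x := by
  have hne : Ω.Nonempty := closure_nonempty_iff.1 ⟨x, frontier_subset_closure hx⟩
  have hxΩ : x ∉ interior Ω := hx.2
  obtain ⟨g, hg0, hg⟩ := geometric_hahn_banach_of_nonempty_interior_point hΩc hxΩ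
    (by rwa [hΩo.interior_eq])
  have hgc : ∀ y ∈ closure Ω, g y ≤ g x := fun y hy =>
    closure_minimal hg (isClosed_le g.continuous continuous_const) hy
  refine ⟨g, fun y hy hyx => lt_of_le_of_ne (hgc y hy) fun heq => hg0 ?_⟩
  have hm := hΩs hy (frontier_subset_closure hx) hyx (a := 1 / 2) (b := 1 / 2)
    (by norm_num) (by norm_num) (by norm_num)
  set p := (1 / 2 : ℝ) • y + (1 / 2 : ℝ) • x with hp
  have hgp : g p = g x := by
    rw [hp, map_add, map_smul, map_smul, heq, smul_eq_mul]; ring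
  have hloc : IsLocalMax g p := by
    filter_upwards [mem_interior_iff_mem_nhds.1 hm] with q hq
    rw [hgp]; exact hgc q hq
  simpa using hloc.fderiv_eq_zero

/-- Strict convexity gives `g` with its only maximum at `x`. A large multiple of `g - g x`, added to
`f x - ε`, stays below `f`: near `x` by continuity, elsewhere by steepness. -/
theorem convexEnvelope_eq_of_mem_frontier (hΩo : IsOpen Ω) (hΩb : Bornology.IsBounded Ω)
    (hΩc : Convex ℝ Ω) (hΩs : StrictConvex ℝ (closure Ω)) (hf : ContinuousOn f (closure Ω))
    {x : Eu d} (hx : x ∈ frontier Ω) : convexEnvelope Ω f x = f x := by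
  have hxc := frontier_subset_closure hx
  refine le_antisymm (convexEnvelope_le hΩb hf fun l hl => hl x hxc) ?_
  refine le_of_forall_pos_sub_le fun ε hε => ?_
  obtain ⟨g, hg⟩ := exists_strict_support hΩo hΩc hΩs hx
  have hF : ContinuousOn (fun y => f y - f x + ε) (closure Ω) := by fun_prop
  obtain ⟨c, hc0, hc⟩ := exists_pos_forall_le_of_isCompact hΩb.isCompact_closure
    (F := fun y => max (f y - f x + ε) (g x - g y)) (hF.sup (by fun_prop)) (fun y hy => by
      by_cases hyx : y = x
      · subst hyx; exact lt_max_of_lt_left (by simpa using hε)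
      · exact lt_max_of_lt_right (sub_pos.2 (hg y hy hyx)))
  obtain ⟨B, hB0, hB⟩ := exists_pos_forall_abs_le_of_isCompact hΩb.isCompact_closure hF
  have hgle : ∀ y ∈ closure Ω, 0 ≤ g x - g y := fun y hy => by
    by_cases hyx : y = x
    · simp [hyx]
    · exact (sub_pos.2 (hg y hy hyx)).le
  have hN : 0 ≤ B / c := by positivity
  have key := affine_le_convexEnvelope (Ω := Ω) (f := f)
    (l := affineOf ((B / c) • g) (f x - ε - (B / c) * g x)) (fun y hy => by
      have h1 : affineOf ((B / c) • g) (f x - ε - (B / c) * g x) y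
          = f x - ε - (B / c) * (g x - g y) := by simp; ring
      rw [h1]
      have h2 := mul_nonneg hN (hgle y hy)
      rcases le_max_iff.1 (hc y hy) with h3 | h3
      · linarith
      · have h4 : B ≤ (B / c) * (g x - g y) := by
          calc B = B / c * c := by field_simp
            _ ≤ _ := mul_le_mul_of_nonneg_left h3 hN
        have := (abs_le.1 (hB y hy)).1
        linarith) hxc
  have h1 : affineOf ((B / c) • g) (f x - ε - (B / c) * g x) x = f x - ε := by simp
  linarith

/-! ### Supporting affine functions and contact sets -/

/-- The point `(x, u x)` is separated from the open strict epigraph. The hyperplane is not vertical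
because the epigraph contains points above `(x, u x)`. -/
theorem ConvexOn.exists_supporting_affine (hΩo : IsOpen Ω) (hu : ConvexOn ℝ (closure Ω) u)
    (hΩc : Convex ℝ Ω) (hc : ContinuousOn u (closure Ω)) {x : Eu d} (hx : x ∈ Ω) :
    ∃ l : Eu d →ᵃ[ℝ] ℝ, (∀ y ∈ closure Ω, l y ≤ u y) ∧ l x = u x := by
  set s : Set (Eu d × ℝ) := {q | q.1 ∈ Ω ∧ u q.1 < q.2} with hs
  have hsc : Convex ℝ s := (hu.subset subset_closure hΩc).convex_strict_epigraph
  have hso : IsOpen s := by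
    rw [isOpen_iff_mem_nhds]
    rintro ⟨y, t⟩ ⟨hy, hyt⟩
    have hcy : ContinuousAt u y :=
      hc.continuousAt (mem_of_superset (hΩo.mem_nhds hy) subset_closure)
    have h1 : ContinuousAt (fun q : Eu d × ℝ => u q.1) (y, t) :=
      ContinuousAt.comp (f := Prod.fst) hcy continuousAt_fst
    filter_upwards [continuousAt_fst.eventually (hΩo.mem_nhds hy),
      h1.eventually_lt continuousAt_snd hyt] with q h2 h3 using ⟨h2, h3⟩
  obtain ⟨F, hF⟩ := geometric_hahn_banach_open_point hsc hso (x := (x, u x))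
    (fun h => lt_irrefl _ h.2)
  set g : StrongDual ℝ (Eu d) := F.comp (ContinuousLinearMap.inl ℝ (Eu d) ℝ) with hg
  set c : ℝ := F (0, 1) with hcdef
  have hFe : ∀ y t, F (y, t) = g y + t * c := fun y t => by
    have : ((y, t) : Eu d × ℝ) = (y, 0) + t • (0, 1) := by simp
    rw [this, map_add, map_smul]
    simp [hg, hcdef]
  have hc0 : c < 0 := by
    have := hF (x, u x + 1) ⟨hx, by simp⟩
    rw [hFe, hFe] at this
    linarith
  refine ⟨affineOf ((-c⁻¹) • g) (u x + c⁻¹ * g x), fun y hy => ?_, by simp⟩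
  refine ContinuousWithinAt.closure_le hy
    (continuous_affineMap _).continuousWithinAt ((hc y hy).mono subset_closure) fun y hy => ?_
  have h1 : g y + u y * c ≤ g x + u x * c := by
    refine le_of_forall_pos_le_add fun ε hε => ?_
    have := hF (y, u y + ε / (-c)) ⟨hy, by
      have : 0 < ε / (-c) := div_pos hε (by linarith)
      simpa using this⟩
    rw [hFe, hFe] at this
    have h2 : ε / (-c) * c = -ε := by
      rw [div_mul_eq_mul_div, div_neg, mul_div_cancel_right₀ _ hc0.ne]
    nlinarith
  have h2 : c * c⁻¹ = 1 := mul_inv_cancel₀ hc0.ne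
  have h3 : c⁻¹ < 0 := inv_lt_zero.2 hc0
  simp only [affineOf_apply, smul_apply, smul_eq_mul]
  have h4 := mul_nonneg_of_nonpos_of_nonpos h3.le (sub_nonpos.2 h1)
  have h5 : c⁻¹ * (g y + u y * c - (g x + u x * c)) = c⁻¹ * g y + u y - c⁻¹ * g x - u x := by
    linear_combination (u y - u x) * h2
  linarith

/-- The properties common to the convex envelope and to viscosity solutions. -/
structure IsEnvelope (Ω : Set (Eu d)) (f u : Eu d → ℝ) : Prop where
  convexOn : ConvexOn ℝ (closure Ω) u
  continuousOn : ContinuousOn u (closure Ω)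
  le_obstacle : ∀ x ∈ closure Ω, u x ≤ f x
  boundary : ∀ x ∈ frontier Ω, u x = f x
  le_of_quadratic_le : ∀ x ∈ Ω, ∀ (l : Eu d →ᵃ[ℝ] ℝ) (η : ℝ), 0 < η →
    (∀ y ∈ closure Ω, l y + η * ‖y - x‖ ^ 2 ≤ f y) → l x ≤ u x

theorem isEnvelope_of_isViscositySolution (hd : 1 ≤ d) (hΩo : IsOpen Ω)
    (hΩb : Bornology.IsBounded Ω) (hΩc : Convex ℝ Ω) (hf : ContinuousOn f (closure Ω))
    (h : IsViscositySolution Ω f u) : IsEnvelope Ω f u where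
  convexOn := h.convexOn hΩo hΩb hΩc
  continuousOn := h.continuousOn
  le_obstacle := h.le_obstacle hΩo hΩb hf
  boundary := h.boundary
  le_of_quadratic_le _ hx l _ hη hl := h.le_of_quadratic_le hd hΩo hΩb hx l hη hl

theorem isEnvelope_of_eqOn_convexEnvelope (hΩo : IsOpen Ω) (hΩb : Bornology.IsBounded Ω)
    (hΩc : Convex ℝ Ω) (hΩs : StrictConvex ℝ (closure Ω)) (hf : ContinuousOn f (closure Ω))
    (hu : ContinuousOn u (closure Ω)) (h : EqOn u (convexEnvelope Ω f) (closure Ω)) :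
    IsEnvelope Ω f u where
  convexOn := (convexOn_convexEnvelope hΩb hΩc hf).congr h.symm
  continuousOn := hu
  le_obstacle x hx := h hx ▸ convexEnvelope_le hΩb hf fun l hl => hl x hx
  boundary x hx := (h (frontier_subset_closure hx)).trans
    (convexEnvelope_eq_of_mem_frontier hΩo hΩb hΩc hΩs hf hx)
  le_of_quadratic_le x hx l η hη hl := by
    rw [h (subset_closure hx)]
    refine affine_le_convexEnvelope (fun y hy => le_trans ?_ (hl y hy)) (subset_closure hx)
    have : 0 ≤ η * ‖y - x‖ ^ 2 := by positivity
    linarith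

/-- By Carathéodory's theorem, the convex hull of a compact set of `ℝ^d` is compact. -/
theorem isCompact_convexHull_of_isCompact {A : Set (Eu d)} (hA : IsCompact A) :
    IsCompact (convexHull ℝ A) := by
  have heq : convexHull ℝ A = ⋃ n ∈ Finset.range (d + 2),
      (fun q : (Fin n → ℝ) × (Fin n → Eu d) => ∑ i, q.1 i • q.2 i) ''
        (stdSimplex ℝ (Fin n) ×ˢ univ.pi fun _ => A) := by
    ext x
    simp only [mem_iUnion, exists_prop, Finset.mem_range]
    constructor
    · intro hx
      obtain ⟨ι, _, z, w, hz, hind, hw0, hw1, hwx⟩ := eq_pos_convex_span_of_mem_convexHull hx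
      have hcard : Fintype.card ι ≤ d + 1 :=
        hind.card_le_finrank_succ.trans (Nat.succ_le_succ
          ((Submodule.finrank_le _).trans (by simp)))
      let e := (Fintype.equivFin ι).symm
      refine ⟨Fintype.card ι, by omega, (w ∘ e, z ∘ e), ⟨⟨fun i => (hw0 _).le, ?_⟩,
        fun i _ => hz ⟨_, rfl⟩⟩, ?_⟩
      · rw [← hw1]; exact e.sum_comp w
      · rw [← hwx]; exact e.sum_comp fun i => w i • z i
    · rintro ⟨n, -, ⟨w, z⟩, ⟨hw, hz⟩, rfl⟩
      exact (convex_convexHull ℝ A).sum_mem (fun i _ => hw.1 i) hw.2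
        fun i _ => subset_convexHull ℝ A (hz i (mem_univ i))
  rw [heq]
  refine (Finset.range (d + 2)).isCompact_biUnion fun n _ => ?_
  exact ((isCompact_stdSimplex ℝ (Fin n)).prod (isCompact_univ_pi fun _ => hA)).image
    (by fun_prop)

/-- A point is in the convex hull of the contact set of its supporting affine function. -/
theorem IsEnvelope.mem_convexHull_contact (hΩb : Bornology.IsBounded Ω)
    (h : IsEnvelope Ω f u) (hf : ContinuousOn f (closure Ω)) {x : Eu d} (hx : x ∈ Ω)
    {l : Eu d →ᵃ[ℝ] ℝ} (hl : ∀ y ∈ closure Ω, l y ≤ u y) (hlx : l x = u x) :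
    x ∈ convexHull ℝ {y ∈ closure Ω | f y = l y} := by
  have hK : IsCompact (closure Ω) := hΩb.isCompact_closure
  set A := {y ∈ closure Ω | f y = l y} with hA
  have hFc : ContinuousOn (fun y => f y - l y) (closure Ω) :=
    hf.sub (continuous_affineMap l).continuousOn
  have hAc : IsCompact A := by
    have : A = closure Ω ∩ (fun y => f y - l y) ⁻¹' {0} := by
      ext y; simp [hA, sub_eq_zero]
    rw [this]
    exact hK.of_isClosed_subset (hFc.preimage_isClosed_of_isClosed isClosed_closure
      isClosed_singleton) inter_subset_left
  by_contra hcon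
  -- Otherwise `l` can be tilted up at `x` and down on the contact set: `l + ε(g - β)`, with a small
  -- paraboloid added, is still below `f` but exceeds `u x` at `x`.
  obtain ⟨g, β, hg, hgx⟩ := geometric_hahn_banach_closed_point (convex_convexHull ℝ A)
    (isCompact_convexHull_of_isCompact hAc).isClosed hcon
  have hF0 : ∀ y ∈ closure Ω, 0 ≤ f y - l y := fun y hy =>
    sub_nonneg.2 ((hl y hy).trans (h.le_obstacle y hy))
  obtain ⟨c, hc0, hc⟩ := exists_pos_forall_le_of_isCompact hK
    (F := fun y => max (f y - l y) (β - g y)) (hFc.sup (by fun_prop)) (fun y hy => by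
      rcases (hF0 y hy).eq_or_lt with h0 | h0
      · exact lt_max_of_lt_right (sub_pos.2 (hg y (subset_convexHull ℝ A
          ⟨hy, (sub_eq_zero.1 h0.symm)⟩)))
      · exact lt_max_of_lt_left h0)
  obtain ⟨G, hG0, hG⟩ := exists_pos_forall_abs_le_of_isCompact hK
    (F := fun y => g y - β) (by fun_prop)
  obtain ⟨D, hD0, hD⟩ := exists_pos_forall_abs_le_of_isCompact hK
    (F := fun y => ‖y - x‖ ^ 2) (by fun_prop)
  -- Where `f - l ≥ c`, tilt and paraboloid cost at most `c / 2` each; where `β - g ≥ c`, the tilt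
  -- lowers by at least `ε c`, which pays for the paraboloid.
  set ε := c / (2 * G) with hε
  have hε0 : 0 < ε := by positivity
  set η := min (c / 2) (ε * c) / D with hη
  have hη0 : 0 < η := by positivity
  have hηD : ∀ y ∈ closure Ω, η * ‖y - x‖ ^ 2 ≤ min (c / 2) (ε * c) := fun y hy => by
    calc η * ‖y - x‖ ^ 2 ≤ η * D :=
          mul_le_mul_of_nonneg_left ((le_abs_self _).trans (hD y hy)) hη0.le
      _ = _ := by rw [hη]; field_simp
  have := h.le_of_quadratic_le x hx (l + affineOf (ε • g) (-(ε * β))) η hη0 fun y hy => by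
    have h1 : (l + affineOf (ε • g) (-(ε * β))) y = l y + ε * (g y - β) := by simp; ring
    rw [h1]
    have h2 := hηD y hy
    rcases le_max_iff.1 (hc y hy) with h3 | h3
    · have h4 : ε * (g y - β) ≤ c / 2 := by
        calc ε * (g y - β) ≤ ε * G :=
              mul_le_mul_of_nonneg_left ((le_abs_self _).trans (hG y hy)) hε0.le
          _ = c / 2 := by rw [hε]; field_simp
      linarith [h2.trans (min_le_left _ _)]
    · have h4 : ε * c ≤ ε * (β - g y) := mul_le_mul_of_nonneg_left h3 hε0.le
      linarith [h2.trans (min_le_right _ _), hF0 y hy]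
  have h1 : (l + affineOf (ε • g) (-(ε * β))) x = l x + ε * (g x - β) := by simp; ring
  rw [h1, hlx] at this
  have h2 : 0 < ε * (g x - β) := mul_pos hε0 (sub_pos.2 hgx)
  linarith

/-- Away from the contact set, `u` is affine on a segment centered at `x`: its half-length is at
least the distance to some contact point, divided by the dimension. -/
theorem IsEnvelope.exists_contact (hΩb : Bornology.IsBounded Ω)
    (h : IsEnvelope Ω f u) (hf : ContinuousOn f (closure Ω)) {x : Eu d} (hx : x ∈ Ω)
    (hxf : u x < f x) {l : Eu d →ᵃ[ℝ] ℝ} (hl : ∀ y ∈ closure Ω, l y ≤ u y) (hlx : l x = u x) :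
    ∃ y ∈ closure Ω, u y = f y ∧ ∀ r > 0, d * r ≤ dist y x →
      ∃ v : Eu d, ‖v‖ = 1 ∧ u (x + r • v) = l (x + r • v) ∧ u (x - r • v) = l (x - r • v) := by
  classical
  set A := {y ∈ closure Ω | f y = l y} with hA
  set E := {y ∈ closure Ω | u y ≤ l y} with hE
  have hEc : Convex ℝ E := by
    have hconc : ConcaveOn ℝ (closure Ω) l :=
      ⟨h.convexOn.1, fun y _ z _ a b _ _ hab => (affineMap_combo l hab y z).ge⟩
    have := (h.convexOn.sub hconc).convex_le 0
    convert this using 3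
    simp
  have hAE : A ⊆ E := fun y hy => ⟨hy.1, (h.le_obstacle y hy.1).trans hy.2.le⟩
  have hxE : x ∈ E := ⟨subset_closure hx, hlx.ge⟩
  obtain ⟨ι, _, z, w, hz, hind, hw0, hw1, hwx⟩ :=
    eq_pos_convex_span_of_mem_convexHull (h.mem_convexHull_contact hΩb hf hx hl hlx)
  have hcard : Fintype.card ι ≤ d + 1 := by
    have := hind.card_le_finrank_succ
    refine this.trans (Nat.succ_le_succ ?_)
    exact (Submodule.finrank_le _).trans (by simp)
  -- At most `d + 1` weights sum to one, so one of them is at least the average.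
  obtain ⟨i, hi⟩ : ∃ i, 1 / ((d : ℝ) + 1) ≤ w i := by
    by_contra! hcon
    have hne : (Finset.univ : Finset ι).Nonempty := by
      rw [Finset.univ_nonempty_iff]
      by_contra hemp
      rw [not_nonempty_iff] at hemp
      simp at hw1
    have h1 := Finset.sum_lt_sum_of_nonempty hne fun i _ => hcon i
    rw [hw1, Finset.sum_const, Finset.card_univ, nsmul_eq_mul] at h1
    have h2 : (Fintype.card ι : ℝ) * (1 / ((d : ℝ) + 1)) ≤ 1 := by
      rw [mul_one_div, div_le_one (by positivity)]
      exact_mod_cast hcard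
    linarith
  have hsum : w i + ∑ j ∈ Finset.univ.erase i, w j = 1 := by
    rw [Finset.add_sum_erase _ _ (Finset.mem_univ i), hw1]
  have hsumz : w i • z i + ∑ j ∈ Finset.univ.erase i, w j • z j = x := by
    rw [Finset.add_sum_erase _ (fun j => w j • z j) (Finset.mem_univ i), hwx]
  have hzA : ∀ j, z j ∈ A := fun j => hz ⟨j, rfl⟩
  have hyx : z i ≠ x := fun he => by
    have := (hzA i).2
    rw [he, hlx] at this
    linarith
  have hwi : w i < 1 := by
    by_contra! hcon
    have h0 : ∑ j ∈ Finset.univ.erase i, w j ≤ 0 := by linarith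
    have h1 : Finset.univ.erase i = (∅ : Finset ι) := by
      by_contra hne
      have := Finset.sum_pos (fun j _ => hw0 j) (Finset.nonempty_iff_ne_empty.2 hne)
      linarith
    rw [h1] at hsum hsumz
    simp only [Finset.sum_empty, add_zero] at hsum hsumz
    rw [hsum, one_smul] at hsumz
    exact hyx hsumz
  -- `q` is the average of the other contact points, opposite to `z i` as seen from `x`. As `w i ≥
  -- 1/(d+1)`, its distance to `x` is at least that of `z i` divided by `d`; this is the source of
  -- the factor `d`.
  set q := (1 - w i)⁻¹ • (x - w i • z i) with hq
  have hw1' : 0 < 1 - w i := by linarith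
  have hqE : q ∈ E := by
    have : q = ∑ j ∈ Finset.univ.erase i, ((1 - w i)⁻¹ * w j) • z j := by
      rw [hq, ← hsumz, add_sub_cancel_left, Finset.smul_sum]
      exact Finset.sum_congr rfl fun j _ => smul_smul _ _ _
    rw [this]
    refine hEc.sum_mem (fun j _ => mul_nonneg (by positivity) (hw0 j).le) ?_
      fun j _ => hAE (hzA j)
    rw [← Finset.mul_sum, show ∑ j ∈ Finset.univ.erase i, w j = 1 - w i by linarith]
    exact inv_mul_cancel₀ hw1'.ne'
  have huE : ∀ p ∈ E, u p = l p := fun p hp => le_antisymm hp.2 (hl p hp.1)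
  refine ⟨z i, (hzA i).1, ?_, fun r hr hrd => ?_⟩
  · rw [(hzA i).2]; exact huE _ (hAE (hzA i))
  set D := dist (z i) x with hD
  have hD0 : 0 < D := dist_pos.2 hyx
  have hwi0 := hw0 i
  have hd1 : (1 - w i) / w i ≤ d := by
    rw [div_le_iff₀ hwi0]
    rw [div_le_iff₀ (by positivity)] at hi
    linarith
  have hd0 : 0 < (1 - w i) / w i := by positivity
  have hd2 : 1 ≤ (d : ℝ) := by
    have : (0 : ℝ) < d := hd0.trans_le hd1
    exact_mod_cast this
  refine ⟨D⁻¹ • (z i - x), ?_, huE _ ?_, huE _ ?_⟩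
  · rw [norm_smul, norm_inv, Real.norm_of_nonneg hD0.le, ← dist_eq_norm]
    exact inv_mul_cancel₀ hD0.ne'
  · rw [smul_smul]
    refine hEc.add_smul_sub_mem hxE (hAE (hzA i)) ⟨by positivity, ?_⟩
    rw [← div_eq_mul_inv, div_le_one hD0]
    nlinarith
  · have h1 : x - r • D⁻¹ • (z i - x) = x + (r * D⁻¹ * ((1 - w i) / w i)) • (q - x) := by
      have h2 : (1 - w i) • (q - x) = w i • (x - z i) := by
        rw [smul_sub, hq, smul_smul, mul_inv_cancel₀ hw1'.ne']
        module
      have h3 : ((1 - w i) / w i) • (q - x) = x - z i := by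
        rw [div_eq_inv_mul, mul_smul, h2, smul_smul, inv_mul_cancel₀ hwi0.ne', one_smul]
      rw [mul_smul, h3, mul_smul]
      module
    rw [h1]
    refine hEc.add_smul_sub_mem hxE hqE ⟨by positivity, ?_⟩
    calc r * D⁻¹ * ((1 - w i) / w i) ≤ r * D⁻¹ * d :=
          mul_le_mul_of_nonneg_left hd1 (by positivity)
      _ = d * r / D := by ring
      _ ≤ 1 := (div_le_one hD0).2 hrd

end

section

variable {d : ℕ} {Ω : Set (Eu d)} {k : ℕ} {α : ℝ}

/-! ### Taylor expansions in Hölder classes -/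

theorem holderSeminorm_nonneg (k : ℕ) (α : ℝ) (Ω : Set (Eu d)) (w : Eu d → ℝ) :
    0 ≤ holderSeminorm k α Ω w :=
  Real.sSup_nonneg (by rintro _ ⟨x, -, y, -, -, rfl⟩; positivity)

theorem IsHolder.norm_sub_le {w : Eu d → ℝ} (hw : IsHolder k α Ω w) {x y : Eu d}
    (hx : x ∈ Ω) (hy : y ∈ Ω) :
    ‖iteratedFDeriv ℝ k w x - iteratedFDeriv ℝ k w y‖ ≤
      holderSeminorm k α Ω w * dist x y ^ α := by
  by_cases hxy : x = y
  · subst hxy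
    rw [sub_self, norm_zero]
    exact mul_nonneg (holderSeminorm_nonneg k α Ω w) (Real.rpow_nonneg dist_nonneg _)
  obtain ⟨K, hK⟩ := hw.holder
  have hpos : ∀ {x y : Eu d}, x ≠ y → 0 < dist x y ^ α := fun h =>
    Real.rpow_pos_of_pos (dist_pos.2 h) _
  rw [← div_le_iff₀ (hpos hxy)]
  -- The constant `K` is needed here: without boundedness the supremum would be the default value
  -- `0`.
  refine le_csSup ⟨K, ?_⟩ ⟨x, hx, y, hy, hxy, rfl⟩
  rintro _ ⟨x, hx, y, hy, hxy, rfl⟩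
  rw [div_le_iff₀ (hpos hxy)]
  exact hK x hx y hy

theorem IsHolder.differentiableAt {w : Eu d → ℝ} (hw : IsHolder 1 α Ω w) (hΩo : IsOpen Ω)
    {x : Eu d} (hx : x ∈ Ω) : DifferentiableAt ℝ w x :=
  (hw.contDiffOn.differentiableOn (by norm_num)).differentiableAt (hΩo.mem_nhds hx)

theorem IsHolder.norm_fderiv_sub_le {w : Eu d → ℝ} (hw : IsHolder 1 α Ω w) {x y : Eu d}
    (hx : x ∈ Ω) (hy : y ∈ Ω) :
    ‖fderiv ℝ w x - fderiv ℝ w y‖ ≤ holderSeminorm 1 α Ω w * dist x y ^ α := by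
  refine le_trans ?_ (hw.norm_sub_le hx hy)
  refine ContinuousLinearMap.opNorm_le_bound _ (norm_nonneg _) fun v => ?_
  have := (iteratedFDeriv ℝ 1 w x - iteratedFDeriv ℝ 1 w y).le_opNorm fun _ => v
  simpa [iteratedFDeriv_one_apply] using this

/-- The Taylor polynomial of order `k` of a `C^{k,α}` function, `k ≤ 1`. -/
theorem IsHolder.exists_taylor (hΩo : IsOpen Ω) (hΩc : Convex ℝ Ω) (hk : k ≤ 1) (hα : 0 < α)
    {w : Eu d → ℝ} (hw : IsHolder k α Ω w) {p : Eu d} (hp : p ∈ Ω) :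
    ∃ A : StrongDual ℝ (Eu d), (k = 0 → A = 0) ∧ (k = 1 → A = fderiv ℝ w p) ∧
      ∀ y ∈ closure Ω, |w y - w p - A (y - p)| ≤
        holderSeminorm k α Ω w * dist y p ^ ((k : ℝ) + α) := by
  have hN := holderSeminorm_nonneg k α Ω w
  have hcl : ∀ A : StrongDual ℝ (Eu d), (∀ y ∈ Ω, |w y - w p - A (y - p)| ≤
      holderSeminorm k α Ω w * dist y p ^ ((k : ℝ) + α)) → ∀ y ∈ closure Ω,
      |w y - w p - A (y - p)| ≤ holderSeminorm k α Ω w * dist y p ^ ((k : ℝ) + α) := by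
    intro A hA y hy
    have h1 : ContinuousWithinAt (fun y => |w y - w p - A (y - p)|) Ω y :=
      ((((hw.continuousOn y hy).mono subset_closure).sub continuousWithinAt_const).sub
        (by fun_prop)).abs
    have h2 : Continuous fun y : Eu d =>
        holderSeminorm k α Ω w * dist y p ^ ((k : ℝ) + α) :=
      continuous_const.mul ((continuous_id.dist continuous_const).rpow_const
        fun _ => Or.inr (by positivity))
    exact ContinuousWithinAt.closure_le hy h1 h2.continuousWithinAt hA
  obtain rfl | rfl : k = 0 ∨ k = 1 := by omega
  · refine ⟨0, fun _ => rfl, by simp, hcl 0 fun y hy => ?_⟩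
    have h1 := hw.norm_sub_le hy hp
    have h2 : |w y - w p| ≤ ‖iteratedFDeriv ℝ 0 w y - iteratedFDeriv ℝ 0 w p‖ := by
      have := (iteratedFDeriv ℝ 0 w y - iteratedFDeriv ℝ 0 w p).le_opNorm (fun _ => 0)
      simpa using this
    simpa using h2.trans h1
  · refine ⟨fderiv ℝ w p, by simp, fun _ => rfl, hcl _ fun y hy => ?_⟩
    by_cases hyp : y = p
    · subst hyp
      simpa using mul_nonneg hN (Real.rpow_nonneg le_rfl _)
    have hseg : segment ℝ p y ⊆ Ω := hΩc.segment_subset hp hy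
    have := (convex_segment p y).norm_image_sub_le_of_norm_hasFDerivWithin_le' (f := w)
      (f' := fderiv ℝ w) (φ := fderiv ℝ w p)
      (C := holderSeminorm 1 α Ω w * dist y p ^ α)
      (fun z hz => (hw.differentiableAt hΩo (hseg hz)).hasFDerivAt.hasFDerivWithinAt)
      (fun z hz => (hw.norm_fderiv_sub_le (hseg hz) hp).trans
        (mul_le_mul_of_nonneg_left (Real.rpow_le_rpow dist_nonneg (by
          rw [segment_eq_image'] at hz
          obtain ⟨t, ht, rfl⟩ := hz
          rw [dist_eq_norm, dist_eq_norm, add_sub_cancel_left, norm_smul,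
            Real.norm_of_nonneg ht.1]
          exact mul_le_of_le_one_left (norm_nonneg _) ht.2) hα.le) hN))
      (left_mem_segment ℝ p y) (right_mem_segment ℝ p y)
    rw [← dist_eq_norm y p] at this
    rw [Nat.cast_one, Real.rpow_add (dist_pos.2 hyp), Real.rpow_one]
    refine this.trans (le_of_eq (by ring))

/-- Growth of the gap of two `C^{k,α}` functions away from an interior contact point. -/
theorem IsHolder.gap_le (hΩo : IsOpen Ω) (hΩc : Convex ℝ Ω) (hk : k ≤ 1) (hα : 0 < α)
    {f u : Eu d → ℝ} (hf : IsHolder k α Ω f) (hu : IsHolder k α Ω u)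
    (hle : ∀ y ∈ closure Ω, u y ≤ f y) {p : Eu d} (hp : p ∈ Ω) (hpe : u p = f p) {y : Eu d}
    (hy : y ∈ closure Ω) :
    f y - u y ≤ (holderSeminorm k α Ω f + holderSeminorm k α Ω u) *
      dist y p ^ ((k : ℝ) + α) := by
  obtain ⟨A, hA0, hA1, hA⟩ := hf.exists_taylor hΩo hΩc hk hα hp
  obtain ⟨B, hB0, hB1, hB⟩ := hu.exists_taylor hΩo hΩc hk hα hp
  -- For `k = 1` the contact point is an interior minimum of `f - u`, so the gradients agree and the
  -- first-order terms cancel.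
  have hAB : A = B := by
    obtain rfl | rfl : k = 0 ∨ k = 1 := by omega
    · rw [hA0 rfl, hB0 rfl]
    · have hmin : IsLocalMin (fun y => f y - u y) p := by
        filter_upwards [hΩo.mem_nhds hp] with y hy
        have := hle y (subset_closure hy)
        simp only [hpe, sub_self]
        linarith
      have := hmin.fderiv_eq_zero
      rw [fderiv_fun_sub (hf.differentiableAt hΩo hp) (hu.differentiableAt hΩo hp),
        sub_eq_zero] at this
      rw [hA1 rfl, hB1 rfl, this]
  have h1 := (abs_le.1 (hA y hy)).2
  have h2 := (abs_le.1 (hB y hy)).1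
  rw [hAB] at h1
  rw [add_mul]
  linarith

/-- Growth of a `C^{k,α}` function away from its contact points with an affine function. -/
theorem IsHolder.exists_le_of_support (hΩo : IsOpen Ω) (hΩc : Convex ℝ Ω) (hk : k ≤ 1)
    (hα : 0 < α) {u : Eu d → ℝ} (hu : IsHolder k α Ω u) {l : Eu d →ᵃ[ℝ] ℝ}
    (hl : ∀ y ∈ closure Ω, l y ≤ u y) :
    ∃ A : StrongDual ℝ (Eu d), ∀ p ∈ Ω, u p = l p → ∀ y ∈ closure Ω,
      u y ≤ l p + A (y - p) + holderSeminorm k α Ω u * dist y p ^ ((k : ℝ) + α) := by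
  -- The same linear part serves all contact points, since for `k = 1` the gradient of `u` at each
  -- of them is that of `l`. This lets the first-order terms at opposite ends cancel later.
  refine ⟨if k = 0 then 0 else l.linear.toContinuousLinearMap, fun p hp hpe y hy => ?_⟩
  obtain ⟨A, hA0, hA1, hA⟩ := hu.exists_taylor hΩo hΩc hk hα hp
  have hAeq : A = if k = 0 then 0 else l.linear.toContinuousLinearMap := by
    obtain rfl | rfl : k = 0 ∨ k = 1 := by omega
    · rw [if_pos rfl, hA0 rfl]
    · rw [if_neg one_ne_zero, hA1 rfl]
      have hmin : IsLocalMin (fun y => u y - l y) p := by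
        filter_upwards [hΩo.mem_nhds hp] with y hy
        have := hl y (subset_closure hy)
        simp only [hpe, sub_self]
        linarith
      have hlder : HasFDerivAt l l.linear.toContinuousLinearMap p := by
        have h1 : (l : Eu d → ℝ) = fun y => l.linear.toContinuousLinearMap y + l 0 :=
          l.decomp
        rw [h1]
        exact (l.linear.toContinuousLinearMap.hasFDerivAt).add_const _
      have := hmin.fderiv_eq_zero
      rw [fderiv_fun_sub (hu.differentiableAt hΩo hp) hlder.differentiableAt, sub_eq_zero,
        hlder.fderiv] at this
      exact this
  rw [← hAeq, ← hpe]
  linarith [(abs_le.1 (hA y hy)).2]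

/-! ### The distance to the boundary -/

/-- The distance to the complement of a convex open set is the minimum of the distances to its
supporting hyperplanes. -/
theorem exists_support_infDist_compl (hΩo : IsOpen Ω) (hΩc : Convex ℝ Ω)
    (hne : (Ωᶜ).Nonempty) {x : Eu d} (hx : x ∈ closure Ω) :
    ∃ (n : Eu d) (H : ℝ), ‖n‖ = 1 ∧
      (∀ y ∈ closure Ω, Metric.infDist y Ωᶜ ≤ H - inner ℝ n y) ∧
      Metric.infDist x Ωᶜ = H - inner ℝ n x := by
  obtain ⟨z, hz, hxz⟩ := hΩo.isClosed_compl.exists_infDist_eq_dist hne x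
  obtain ⟨g, hg⟩ := geometric_hahn_banach_open_point hΩc hΩo hz
  set w := (InnerProductSpace.toDual ℝ (Eu d)).symm g with hw
  have hgw : ∀ y, g y = inner ℝ w y := fun y =>
    (InnerProductSpace.toDual_symm_apply (x := y) (y := g)).symm
  have hw0 : 0 < ‖w‖ := by
    obtain ⟨y, hy⟩ := closure_nonempty_iff.1 ⟨x, hx⟩
    refine norm_pos_iff.2 fun h0 => ?_
    have := hg y hy
    rw [hgw, hgw, h0] at this
    simp at this
  set n := ‖w‖⁻¹ • w with hn
  have hn1 : ‖n‖ = 1 := by rw [hn, norm_smul, norm_inv, norm_norm, inv_mul_cancel₀ hw0.ne']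
  have hnlt : ∀ y ∈ Ω, inner ℝ n y < inner ℝ n z := fun y hy => by
    have := hg y hy
    rw [hgw, hgw] at this
    simp only [hn, inner_smul_left, conj_trivial]
    exact mul_lt_mul_of_pos_left this (by positivity)
  have hle : ∀ y ∈ closure Ω, Metric.infDist y Ωᶜ ≤ inner ℝ n z - inner ℝ n y := by
    intro y hy
    have h0 : inner ℝ n y ≤ inner ℝ n z :=
      closure_minimal (t := {y | inner ℝ n y ≤ inner ℝ n z}) (fun y hy => (hnlt y hy).le)
        (isClosed_le (by fun_prop) continuous_const) hy
    by_contra! hlt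
    set s := inner ℝ n z - inner ℝ n y with hs
    have hs0 : 0 ≤ s := sub_nonneg.2 h0
    -- If the distance exceeded `s`, a point of the supporting hyperplane would belong to the open
    -- set `Ω`.
    have hmem : y + s • n ∈ Ω := Metric.ball_infDist_compl_subset (by
      rw [Metric.mem_ball, dist_eq_norm, add_sub_cancel_left, norm_smul, hn1,
        Real.norm_of_nonneg hs0, mul_one]
      exact hlt)
    have := hnlt _ hmem
    rw [inner_add_right, inner_smul_right, real_inner_self_eq_norm_sq, hn1] at this
    linarith
  refine ⟨n, inner ℝ n z, hn1, hle, le_antisymm (hle x hx) ?_⟩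
  rw [hxz, ← inner_sub_right, dist_comm, dist_eq_norm]
  have := real_inner_le_norm n (z - x)
  rwa [hn1, one_mul] at this

/-! ### The boundary layer barrier -/

/-- The profile of the boundary layer barrier. -/
noncomputable def profile (s : ℝ) : ℝ := max 0 (1 - √s) ^ 2

theorem profile_nonneg (s : ℝ) : 0 ≤ profile s := by unfold profile; positivity

theorem profile_le_one (s : ℝ) : profile s ≤ 1 := by
  unfold profile
  have h1 : max 0 (1 - √s) ≤ 1 := max_le zero_le_one (by linarith [Real.sqrt_nonneg s])
  have h2 : 0 ≤ max 0 (1 - √s) := le_max_left _ _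
  exact pow_le_one₀ h2 h1

theorem profile_antitone : Antitone profile := by
  intro s t hst
  unfold profile
  have h2 : 0 ≤ max 0 (1 - √t) := le_max_left _ _
  have h3 := Real.sqrt_le_sqrt hst
  gcongr

theorem convexOn_profile : ConvexOn ℝ (Ici 0) profile := by
  have h1 : ConvexOn ℝ (Ici 0) fun s : ℝ => 1 - √s :=
    (convexOn_const (1 : ℝ) (convex_Ici (0 : ℝ))).sub Real.strictConcaveOn_sqrt.concaveOn
  have h2 := (convexOn_const (0 : ℝ) (convex_Ici (0 : ℝ))).sup h1
  exact h2.pow (fun x _ => le_max_left _ _) 2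

/-- The profile is strongly convex near the boundary. -/
theorem profile_second_diff {s r : ℝ} (hs : 0 < s) (hr : 0 ≤ r) (hrs : r ≤ s)
    (h1 : s + r ≤ 1) :
    r ^ 2 / (2 * s) ≤ profile (s + r) + profile (s - r) - 2 * profile s := by
  have hle : ∀ t, t ≤ 1 → profile t = (1 - √t) ^ 2 := fun t ht => by
    rw [profile, max_eq_right (sub_nonneg.2 (Real.sqrt_le_one.2 ht))]
  rw [hle _ h1, hle _ (by linarith), hle _ (by linarith)]
  have ha := Real.sq_sqrt (show 0 ≤ s - r by linarith)
  have hb := Real.sq_sqrt (show 0 ≤ s + r by linarith)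
  have hc := Real.sq_sqrt hs.le
  have hc0 : 0 < √s := Real.sqrt_pos.2 hs
  have hc1 : √s ≤ 1 := Real.sqrt_le_one.2 (by linarith)
  have ha0 := Real.sqrt_nonneg (s - r)
  have hb0 := Real.sqrt_nonneg (s + r)
  set a := √(s - r)
  set b := √(s + r)
  set c := √s
  -- By this identity the second difference is `2(2c - a - b)`, and `(b - a)² = (2c - a - b)(2c + a
  -- + b)` bounds that factor from below.
  have hab : a ^ 2 + b ^ 2 = 2 * c ^ 2 := by linarith
  have hsum : a + b ≤ 2 * c := abs_le_of_sq_le_sq' (by nlinarith [sq_nonneg (a - b)])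
    (by positivity) |>.2
  have hdiff : r ≤ (b - a) * c := by
    have h2 : (b - a) * (a + b) = 2 * r := by linear_combination hb - ha
    have h3 : 0 ≤ b - a := sub_nonneg.2 (Real.sqrt_le_sqrt (by linarith))
    nlinarith
  have hkey : (b - a) ^ 2 ≤ 4 * c * (2 * c - a - b) := by
    have h2 : (b - a) ^ 2 = (2 * c - (a + b)) * (2 * c + (a + b)) := by
      linear_combination 2 * hab
    rw [h2]
    nlinarith
  have hrc : r ^ 2 ≤ (b - a) ^ 2 * c ^ 2 := by
    rw [← mul_pow]; exact pow_le_pow_left₀ hr hdiff 2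
  have hexp : (1 - b) ^ 2 + (1 - a) ^ 2 - 2 * (1 - c) ^ 2 = 2 * (2 * c - a - b) := by
    linear_combination hab
  rw [hexp, div_le_iff₀ (by positivity), ← hc]
  have h5 : 0 ≤ 2 * c - a - b := by linarith
  calc r ^ 2 ≤ (b - a) ^ 2 * c ^ 2 := hrc
    _ ≤ 4 * c * (2 * c - a - b) * c ^ 2 := mul_le_mul_of_nonneg_right hkey (by positivity)
    _ = (4 * (2 * c - a - b) * c ^ 2) * c := by ring
    _ ≤ (4 * (2 * c - a - b) * c ^ 2) * 1 := mul_le_mul_of_nonneg_left hc1 (by positivity)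
    _ = _ := by ring

/-- The boundary layer barrier is convex. -/
theorem convexOn_profile_infDist (hΩo : IsOpen Ω) (hΩc : Convex ℝ Ω) (hne : (Ωᶜ).Nonempty)
    {ρ : ℝ} (hρ : 0 < ρ) :
    ConvexOn ℝ (closure Ω) fun x => profile (Metric.infDist x Ωᶜ / ρ) := by
  refine ⟨hΩc.closure, fun x hx y hy a b ha hb hab => ?_⟩
  -- At the intermediate point the distance is that to one hyperplane, an affine function; at the
  -- endpoints it is no larger than this function, and the profile is decreasing and convex.
  obtain ⟨n, H, -, hle, heq⟩ := exists_support_infDist_compl hΩo hΩc hne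
    (hΩc.closure hx hy ha hb hab)
  have h1 : (H - inner ℝ n (a • x + b • y)) / ρ =
      a • ((H - inner ℝ n x) / ρ) + b • ((H - inner ℝ n y) / ρ) := by
    simp only [inner_add_right, inner_smul_right, smul_eq_mul]
    obtain rfl : b = 1 - a := by linarith
    ring
  have hle' : ∀ z ∈ closure Ω, Metric.infDist z Ωᶜ / ρ ≤ (H - inner ℝ n z) / ρ := fun z hz =>
    div_le_div_of_nonneg_right (hle z hz) hρ.le
  have hnn : ∀ z ∈ closure Ω, 0 ≤ (H - inner ℝ n z) / ρ := fun z hz =>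
    le_trans (div_nonneg Metric.infDist_nonneg hρ.le) (hle' z hz)
  simp only [heq, h1]
  refine (convexOn_profile.2 (hnn x hx) (hnn y hy) ha hb hab).trans ?_
  simp only [smul_eq_mul]
  exact add_le_add (mul_le_mul_of_nonneg_left (profile_antitone (hle' x hx)) ha)
    (mul_le_mul_of_nonneg_left (profile_antitone (hle' y hy)) hb)

end

section

variable {d : ℕ} {Ω : Set (Eu d)} {M : Mesh d}

/-! ### Convex combinations of the vertices of an element -/

/-- `y` is the combination of the vertices of the element `s` with the weights `c`. -/
structure Mesh.IsCombo (M : Mesh d) (s : Finset (Eu d)) (c : Eu d → ℝ) (y : Eu d) : Prop where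
  mem : s ∈ M.elements
  nonneg : ∀ z ∈ s, 0 ≤ c z
  sum_one : ∑ z ∈ s, c z = 1
  sum_smul : ∑ z ∈ s, c z • z = y

theorem Mesh.exists_isCombo {y : Eu d} (hy : y ∈ M.carrier) : ∃ s c, M.IsCombo s c y := by
  obtain ⟨s, hs, hys⟩ := Mesh.mem_carrier.1 hy
  obtain ⟨c, h0, h1, h2⟩ := Finset.mem_convexHull'.1 hys
  exact ⟨s, c, hs, h0, h1, h2⟩

namespace Mesh.IsCombo

variable {s : Finset (Eu d)} {c : Eu d → ℝ} {y : Eu d}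

theorem mem_simplexSet (h : M.IsCombo s c y) : y ∈ simplexSet s :=
  Finset.mem_convexHull'.2 ⟨c, h.nonneg, h.sum_one, h.sum_smul⟩

theorem dist_le (h : M.IsCombo s c y) {z : Eu d} (hz : z ∈ s) : dist z y ≤ M.size :=
  Mesh.dist_le_size h.mem (Mesh.mem_simplexSet_of_mem hz) h.mem_simplexSet

theorem eq_sum (h : M.IsCombo s c y) {w : Eu d → ℝ} (hw : M.IsPiecewiseLinear w) :
    w y = ∑ z ∈ s, c z * w z := by
  obtain ⟨l, hl⟩ := hw.affine s h.mem
  rw [hl h.mem_simplexSet, ← h.sum_smul, affineMap_sum l h.sum_one]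
  exact Finset.sum_congr rfl fun z hz => by rw [hl (Mesh.mem_simplexSet_of_mem hz)]

theorem convexOn_le (h : M.IsCombo s c y) {G : Eu d → ℝ} (hG : ConvexOn ℝ (closure Ω) G)
    (hM : M.nodes ⊆ closure Ω) : G y ≤ ∑ z ∈ s, c z * G z := by
  rw [← h.sum_smul]
  exact hG.map_sum_le h.nonneg h.sum_one fun z hz => hM ⟨s, h.mem, hz⟩

theorem sum_le_sum (h : M.IsCombo s c y) {F G : Eu d → ℝ} (hFG : ∀ z ∈ M.nodes, F z ≤ G z) :
    ∑ z ∈ s, c z * F z ≤ ∑ z ∈ s, c z * G z :=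
  Finset.sum_le_sum fun z hz => mul_le_mul_of_nonneg_left (hFG z ⟨s, h.mem, hz⟩) (h.nonneg z hz)

theorem sum_const (h : M.IsCombo s c y) (a : ℝ) : ∑ z ∈ s, c z * a = a := by
  rw [← Finset.sum_mul, h.sum_one, one_mul]

/-- Barycentric averages reproduce affine functions, so Taylor bounds at the vertices pass to the
interpolated value at `y`. -/
theorem sum_le_of_affine (h : M.IsCombo s c y) {u : Eu d → ℝ} {a : ℝ}
    {A : StrongDual ℝ (Eu d)} {p : Eu d} (hu : ∀ z ∈ s, u z ≤ a + A (z - p)) :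
    ∑ z ∈ s, c z * u z ≤ a + A (y - p) := by
  have h1 : ∑ z ∈ s, c z * (a + A (z - p)) = a + A (y - p) := by
    rw [← h.sum_smul]
    simp only [map_sub, map_sum, map_smul, smul_eq_mul, mul_add, mul_sub,
      Finset.sum_add_distrib, Finset.sum_sub_distrib, h.sum_const]
  rw [← h1]
  exact Finset.sum_le_sum fun z hz => mul_le_mul_of_nonneg_left (hu z hz) (h.nonneg z hz)

end Mesh.IsCombo

/-! ### The discrete problem at an interior node -/

theorem Mesh.localScale_pos (hd : 1 ≤ d) {δ : ℝ} (hδ : 0 < δ) {x : Eu d} (hx : x ∈ M.domain) :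
    0 < M.localScale δ x :=
  lt_min hδ (Mesh.infDist_frontier_pos hd hx)

theorem Mesh.add_localScale_mem (hd : 1 ≤ d) {δ : ℝ} (hδ : 0 < δ) {x v : Eu d}
    (hx : x ∈ M.domain) (hv : ‖v‖ = 1) :
    x + M.localScale δ x • v ∈ M.carrier ∧ x - M.localScale δ x • v ∈ M.carrier := by
  have h0 := Mesh.localScale_pos hd hδ hx
  have h1 : ‖M.localScale δ x • v‖ ≤ Metric.infDist x (frontier M.domain) := by
    rw [norm_smul, hv, mul_one, Real.norm_of_nonneg h0.le]
    exact min_le_right _ _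
  constructor <;> refine Mesh.closedBall_infDist_frontier_subset hd hx ?_ <;>
    simpa [Metric.mem_closedBall, dist_eq_norm] using h1

namespace IsDiscreteSolution

variable {δ θ : ℝ} {S : Directions d θ} {f uε : Eu d → ℝ}

theorem le_obstacle (h : IsDiscreteSolution Ω M δ S f uε) {x : Eu d}
    (hx : x ∈ M.interiorNodes Ω) : uε x ≤ f x := by
  have h1 := h.interior x hx
  have := h1.ge.trans (min_le_left _ _)
  linarith

theorem two_mul_le (h : IsDiscreteSolution Ω M δ S f uε) {x : Eu d}
    (hx : x ∈ M.interiorNodes Ω) (hs : 0 < M.localScale δ x) {v : Eu d} (hv : v ∈ S.dirs) :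
    2 * uε x ≤ uε (x + M.localScale δ x • v) + uε (x - M.localScale δ x • v) := by
  have h1 := (h.interior x hx).ge.trans (min_le_right _ _)
  have h2 := h1.trans (Finset.inf'_le _ hv)
  rw [Mesh.secondDiff, le_div_iff₀ (by positivity), zero_mul] at h2
  linarith

theorem eq_obstacle_or (h : IsDiscreteSolution Ω M δ S f uε) {x : Eu d}
    (hx : x ∈ M.interiorNodes Ω) (hs : 0 < M.localScale δ x) : uε x = f x ∨ ∃ v ∈ S.dirs,
    uε (x + M.localScale δ x • v) + uε (x - M.localScale δ x • v) = 2 * uε x := by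
  have h1 := h.interior x hx
  rcases min_choice (f x - uε x) (S.dirs.inf' S.nonempty fun v => M.secondDiff δ uε x v)
    with h2 | h2 <;> rw [twoScaleOp, h2] at h1
  · exact Or.inl (by linarith)
  · obtain ⟨v, hv, h3⟩ := S.dirs.exists_mem_eq_inf' S.nonempty
      fun v => M.secondDiff δ uε x v
    rw [h1, Mesh.secondDiff, eq_comm, div_eq_zero_iff] at h3
    refine Or.inr ⟨v, hv, ?_⟩
    rcases h3 with h3 | h3
    · linarith
    · exact absurd h3 (by positivity)

end IsDiscreteSolution

theorem norm_sq_add_sub (x v : Eu d) (r : ℝ) (hv : ‖v‖ = 1) :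
    ‖x + r • v‖ ^ 2 + ‖x - r • v‖ ^ 2 = 2 * ‖x‖ ^ 2 + 2 * r ^ 2 := by
  rw [norm_add_sq_real, norm_sub_sq_real, norm_smul, hv, mul_one, Real.norm_eq_abs, sq_abs]
  ring

theorem convexOn_norm_sq (hΩc : Convex ℝ Ω) : ConvexOn ℝ (closure Ω) fun x : Eu d => ‖x‖ ^ 2 :=
  ((convexOn_univ_norm.pow (fun _ _ => norm_nonneg _) 2).subset (subset_univ _) hΩc.closure)

/-! ### Discrete comparison -/

section

variable {δ θ : ℝ} {S : Directions d θ} {f u uε : Eu d → ℝ}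

/-- The interpolant of the convex function `u` is a discrete subsolution. -/
theorem IsDiscreteSolution.envelope_le (hd : 1 ≤ d) (hΩo : IsOpen Ω)
    (hΩb : Bornology.IsBounded Ω) (hΩc : Convex ℝ Ω) (hu : IsEnvelope Ω f u)
    (hM : M.IsFitted Ω) (hδ : 0 < δ) (h : IsDiscreteSolution Ω M δ S f uε) :
    ∀ z ∈ M.nodes, u z ≤ uε z := by
  have hnodes := hM.nodes_subset hd hΩc
  obtain ⟨B, hB0, hB⟩ := exists_pos_forall_abs_le_of_isCompact hΩb.isCompact_closure
    (F := fun x : Eu d => ‖x‖ ^ 2) (by fun_prop)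
  suffices key : ∀ η > 0, ∀ z ∈ M.nodes, u z - uε z ≤ η * B by
    intro z hz
    refine le_of_forall_pos_le_add fun ε hε => ?_
    have := key (ε / B) (by positivity) z hz
    rw [div_mul_cancel₀ _ hB0.ne'] at this
    linarith
  intro η hη
  -- The quadratic term makes the midpoint inequality strict; `η` is arbitrary.
  set G : Eu d → ℝ := fun z => u z + η * ‖z‖ ^ 2 with hG
  have hGc : ConvexOn ℝ (closure Ω) G :=
    hu.convexOn.add ((convexOn_norm_sq hΩc).smul hη.le)
  obtain ⟨x, hx, hmax⟩ := M.finite_nodes.exists_maximalFor (fun z => G z - uε z) _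
    M.nonempty_nodes
  have hmax' : ∀ z ∈ M.nodes, G z - uε z ≤ G x - uε x := fun z hz =>
    (le_total (G z - uε z) (G x - uε x)).elim id fun h => hmax hz h
  have hnn : ∀ z : Eu d, 0 ≤ η * ‖z‖ ^ 2 := fun z => by positivity
  suffices hx0 : u x ≤ uε x by
    intro z hz
    have h1 := hmax' z hz
    have h2 : η * ‖x‖ ^ 2 ≤ η * B :=
      mul_le_mul_of_nonneg_left ((le_abs_self _).trans (hB x (hnodes hx))) hη.le
    have h3 := hnn z
    simp only [hG] at h1
    linarith
  by_cases hxb : x ∈ frontier Ω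
  · rw [hu.boundary x hxb, h.boundary x ⟨hx, hxb⟩]
  have hxi : x ∈ M.interiorNodes Ω := ⟨hx, fun hb => hxb hb.2⟩
  obtain ⟨hxΩ, hxd⟩ := hM.mem_of_interior hd hΩc hΩo hxi
  have hr := Mesh.localScale_pos hd hδ hxd
  rcases h.eq_obstacle_or hxi hr with heq | ⟨v, hv, heq⟩
  · rw [heq]; exact hu.le_obstacle x (subset_closure hxΩ)
  exfalso
  have hv1 := S.norm_eq_one v hv
  have hy := Mesh.add_localScale_mem hd hδ hxd hv1
  -- The nodal inequality extends to the whole mesh because `uε` is linear on elements while `G` is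
  -- convex.
  have hkey : ∀ y ∈ M.carrier, G y - (G x - uε x) ≤ uε y := by
    intro y hy
    obtain ⟨s, c, hc⟩ := Mesh.exists_isCombo hy
    rw [hc.eq_sum h.piecewiseLinear]
    have h1 := hc.convexOn_le hGc hnodes
    have h2 := hc.sum_le_sum (F := fun z => G z - (G x - uε x)) (G := uε) fun z hz => by
      linarith [hmax' z hz]
    simp only [mul_sub (c _) (G _), Finset.sum_sub_distrib, hc.sum_const] at h2
    linarith
  have h1 := hkey _ hy.1
  have h2 := hkey _ hy.2
  have hcl := hM.carrier_subset hd hΩc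
  have h3 := hu.convexOn.2 (hcl hy.1) (hcl hy.2) (show (0 : ℝ) ≤ 1 / 2 by norm_num)
    (show (0 : ℝ) ≤ 1 / 2 by norm_num) (by norm_num)
  have h4 : (1 / 2 : ℝ) • (x + M.localScale δ x • v) +
      (1 / 2 : ℝ) • (x - M.localScale δ x • v) = x := by module
  rw [h4, smul_eq_mul, smul_eq_mul] at h3
  have h5 := norm_sq_add_sub x v (M.localScale δ x) hv1
  have h6 : 0 < η * M.localScale δ x ^ 2 := by positivity
  simp only [hG] at h1 h2
  nlinarith

/-- Discrete comparison of the solution with a perturbed interpolant of `u`. -/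
theorem IsDiscreteSolution.sub_le (hd : 1 ≤ d) (hΩo : IsOpen Ω) (hΩc : Convex ℝ Ω)
    (hu : IsEnvelope Ω f u) (hM : M.IsFitted Ω) (hδ : 0 < δ)
    (h : IsDiscreteSolution Ω M δ S f uε) {G : Eu d → ℝ} (hG : ConvexOn ℝ (closure Ω) G)
    (hG0 : ∀ y ∈ closure Ω, 0 ≤ G y) {Γ E : ℝ} (hE : 0 ≤ E) (hGΓ : ∀ y ∈ closure Ω, G y ≤ Γ)
    (halt : ∀ x ∈ M.interiorNodes Ω, f x - u x ≤ E ∨ ∃ v ∈ S.dirs, ∀ s c s' c',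
      M.IsCombo s c (x + M.localScale δ x • v) → M.IsCombo s' c' (x - M.localScale δ x • v) →
      ∑ z ∈ s, c z * u z + ∑ z ∈ s', c' z * u z - 2 * u x <
        G (x + M.localScale δ x • v) + G (x - M.localScale δ x • v) - 2 * G x) :
    ∀ z ∈ M.nodes, uε z - u z ≤ E + Γ := by
  have hnodes := hM.nodes_subset hd hΩc
  obtain ⟨x, hx, hmax⟩ := M.finite_nodes.exists_maximalFor (fun z => uε z - u z + G z) _
    M.nonempty_nodes
  have hmax' : ∀ z ∈ M.nodes, uε z - u z + G z ≤ uε x - u x + G x := fun z hz =>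
    (le_total (uε z - u z + G z) (uε x - u x + G x)).elim id fun h => hmax hz h
  suffices hx0 : uε x - u x ≤ E by
    intro z hz
    linarith [hmax' z hz, hG0 z (hnodes hz), hGΓ x (hnodes hx)]
  by_cases hxb : x ∈ frontier Ω
  · rw [hu.boundary x hxb, h.boundary x ⟨hx, hxb⟩, sub_self]; exact hE
  have hxi : x ∈ M.interiorNodes Ω := ⟨hx, fun hb => hxb hb.2⟩
  obtain ⟨hxΩ, hxd⟩ := hM.mem_of_interior hd hΩc hΩo hxi
  have hr := Mesh.localScale_pos hd hδ hxd
  rcases halt x hxi with hE' | ⟨v, hv, hcombo⟩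
  · linarith [h.le_obstacle hxi]
  exfalso
  have hv1 := S.norm_eq_one v hv
  have hy := Mesh.add_localScale_mem hd hδ hxd hv1
  obtain ⟨s, c, hc⟩ := Mesh.exists_isCombo hy.1
  obtain ⟨s', c', hc'⟩ := Mesh.exists_isCombo hy.2
  -- Maximality at `x` is averaged over an element, with `G` replaced by its smaller value at `y`.
  -- At the two endpoints this bounds the second difference of `G` by that of the interpolant of
  -- `u`, against the strict inequality assumed.
  have hkey : ∀ {y s c}, M.IsCombo s c y →
      uε y ≤ uε x - u x + G x + ∑ z ∈ s, c z * u z - G y := by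
    intro y s c hc
    rw [hc.eq_sum h.piecewiseLinear]
    have h1 := hc.convexOn_le hG hnodes
    have h2 := hc.sum_le_sum (F := uε) (G := fun z => uε x - u x + G x + u z - G z)
      fun z hz => by linarith [hmax' z hz]
    simp only [mul_sub (c _) _ (G _), mul_add (c _) _ (u _), Finset.sum_sub_distrib,
      Finset.sum_add_distrib, hc.sum_const] at h2
    linarith
  linarith [hkey hc, hkey hc', hcombo s c s' c' hc hc', h.two_mul_le hxi hr hv]

end

/-! ### Consistency -/

section

variable {δ θ α σ : ℝ} {k : ℕ} {S : Directions d θ} {f u : Eu d → ℝ}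

theorem Directions.nonneg (hd : 1 ≤ d) (S : Directions d θ) : 0 ≤ θ := by
  obtain ⟨v, hv⟩ := exists_norm_eq_one hd
  obtain ⟨v', -, h⟩ := S.cover v hv
  exact (norm_nonneg _).trans h

/-- Consistency away from the boundary. -/
theorem consistency_interior (hd : 1 ≤ d) (hΩo : IsOpen Ω) (hΩb : Bornology.IsBounded Ω)
    (hΩc : Convex ℝ Ω) (hk : k ≤ 1) (hα : 0 < α) (hu : IsEnvelope Ω f u)
    (hfH : IsHolder k α Ω f) (huH : IsHolder k α Ω u) (hM : M.IsFitted Ω) (hδ : M.size ≤ δ)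
    (S : Directions d θ) {x : Eu d} (hx : x ∈ M.interiorNodes Ω)
    (hxδ : (d + 2) * δ ≤ Metric.infDist x Ωᶜ) :
    M.localScale δ x = δ ∧
    (f x - u x ≤ (holderSeminorm k α Ω f + holderSeminorm k α Ω u) *
        ((d + 2) * δ) ^ ((k : ℝ) + α) ∨
      ∃ v ∈ S.dirs, ∀ s c s' c', M.IsCombo s c (x + δ • v) → M.IsCombo s' c' (x - δ • v) →
        ∑ z ∈ s, c z * u z + ∑ z ∈ s', c' z * u z - 2 * u x ≤
          2 * (holderSeminorm k α Ω u * (δ * θ + M.size) ^ ((k : ℝ) + α))) := by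
  have hsz := Mesh.size_pos (M := M) hd
  have hδ0 : 0 < δ := hsz.trans_le hδ
  have hd0 : (0 : ℝ) ≤ d := Nat.cast_nonneg d
  have hnodes := hM.nodes_subset hd hΩc
  obtain ⟨hxΩ, hxd⟩ := hM.mem_of_interior hd hΩc hΩo hx
  have hUnn := holderSeminorm_nonneg k α Ω u
  have hFnn := holderSeminorm_nonneg k α Ω f
  have hmemΩ : ∀ y, dist y x < (d + 2) * δ → y ∈ Ω := fun y hy =>
    Metric.ball_infDist_compl_subset (Metric.mem_ball.2 (hy.trans_le hxδ))
  constructor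
  -- The distance to the boundary of `Ω_h` is at least `(d+2)δ - h ≥ δ`.
  · refine min_eq_left ?_
    have := hM.infDist_compl_le hd hΩo x
    nlinarith
  rcases (hu.le_obstacle x (subset_closure hxΩ)).eq_or_lt with heq | hlt
  · left
    rw [heq, sub_self]
    positivity
  obtain ⟨l, hl, hlx⟩ := ConvexOn.exists_supporting_affine hΩo hu.convexOn hΩc
    hu.continuousOn hxΩ
  obtain ⟨y, hy, hyf, hseg⟩ := hu.exists_contact hΩb hfH.continuousOn hxΩ hlt hl hlx
  -- A near contact point makes the gap small; a far one yields a segment of half-length `δ` on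
  -- which `u` is affine. Its ends are contact points with `l`, at distance at most `δθ` from the
  -- endpoints in the discrete direction.
  rcases lt_or_ge (dist y x) (d * δ) with hyx | hyx
  · left
    have hyΩ : y ∈ Ω := hmemΩ y (hyx.trans_le (by nlinarith))
    refine (hfH.gap_le hΩo hΩc hk hα huH hu.le_obstacle hyΩ hyf
      (subset_closure hxΩ)).trans (mul_le_mul_of_nonneg_left ?_ (by positivity))
    rw [dist_comm]
    exact Real.rpow_le_rpow dist_nonneg (by nlinarith) (by positivity)
  · right
    obtain ⟨v, hv, hp, hm⟩ := hseg δ hδ0 hyx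
    obtain ⟨v', hv', hvv⟩ := S.cover v hv
    obtain ⟨A, hA⟩ := huH.exists_le_of_support hΩo hΩc hk hα hl
    refine ⟨v', hv', fun s c s' c' hc hc' => ?_⟩
    have hδv : ‖δ • v‖ < (d + 2) * δ := by
      rw [norm_smul, hv, mul_one, Real.norm_of_nonneg hδ0.le]
      nlinarith
    have hstep : ∀ {q w : Eu d} {s c}, q ∈ Ω → u q = l q → M.IsCombo s c w →
        dist w q ≤ δ * θ → ∑ z ∈ s, c z * u z ≤
          l q + holderSeminorm k α Ω u * (δ * θ + M.size) ^ ((k : ℝ) + α) + A (w - q) := by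
      intro q w s c hq hqe hc hwq
      refine hc.sum_le_of_affine fun z hz => ?_
      have h1 := hA q hq hqe z (hnodes ⟨s, hc.mem, hz⟩)
      have h2 : dist z q ^ ((k : ℝ) + α) ≤ (δ * θ + M.size) ^ ((k : ℝ) + α) :=
        Real.rpow_le_rpow dist_nonneg
          (by linarith [dist_triangle z w q, hc.dist_le hz]) (by positivity)
      have h3 := mul_le_mul_of_nonneg_left h2 hUnn
      linarith
    have hnorm : ‖δ • (v' - v)‖ ≤ δ * θ := by
      rw [norm_smul, Real.norm_of_nonneg hδ0.le, norm_sub_rev]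
      exact mul_le_mul_of_nonneg_left hvv hδ0.le
    have h1 := hstep (hmemΩ (x + δ • v) (by simpa [dist_eq_norm] using hδv)) hp hc (by
      rw [dist_eq_norm, show x + δ • v' - (x + δ • v) = δ • (v' - v) by module]
      exact hnorm)
    have h2 := hstep (hmemΩ (x - δ • v) (by simpa [dist_eq_norm] using hδv)) hm hc' (by
      rw [dist_eq_norm, norm_sub_rev,
        show x - δ • v - (x - δ • v') = δ • (v' - v) by module]
      exact hnorm)
    have h3 : l (x + δ • v) + l (x - δ • v) = 2 * u x := by
      rw [sub_eq_add_neg x, affineMap_add, affineMap_add, map_neg, hlx]; ring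
    have h4 : A (x + δ • v' - (x + δ • v)) + A (x - δ • v' - (x - δ • v)) = 0 := by
      rw [← map_add]
      convert map_zero A using 2
      module
    linarith

/-- Near the boundary the gap between obstacle and solution is small. -/
theorem gap_boundary_le (hΩo : IsOpen Ω) (hΩc : Convex ℝ Ω) (hne : (Ωᶜ).Nonempty) (hα : 0 < α)
    (hu : IsEnvelope Ω f u) (hfH : IsHolder 0 α Ω f) (huH : IsHolder 0 α Ω u) {x : Eu d}
    (hx : x ∈ Ω) :
    f x - u x ≤ (holderSeminorm 0 α Ω f + holderSeminorm 0 α Ω u) *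
      Metric.infDist x Ωᶜ ^ α := by
  obtain ⟨z, hz, hxz⟩ := hΩo.isClosed_compl.exists_infDist_eq_dist hne x
  have hpos : 0 < Metric.infDist x Ωᶜ :=
    (hΩo.isClosed_compl.notMem_iff_infDist_pos hne).1 fun h => h hx
  have hzc : z ∈ closure Ω := by
    refine closure_mono (Metric.ball_infDist_compl_subset (x := x) (s := Ω)) ?_
    rw [closure_ball x hpos.ne', Metric.mem_closedBall, dist_comm, hxz]
  have hzf := hu.boundary z (hΩo.frontier_eq ▸ ⟨hzc, hz⟩)
  obtain ⟨A, hA0, -, hA⟩ := hfH.exists_taylor hΩo hΩc zero_le_one hα hx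
  obtain ⟨B, hB0, -, hB⟩ := huH.exists_taylor hΩo hΩc zero_le_one hα hx
  have h1 := (abs_le.1 (hA z hzc)).1
  have h2 := (abs_le.1 (hB z hzc)).2
  rw [hA0 rfl] at h1
  rw [hB0 rfl] at h2
  simp only [zero_apply, Nat.cast_zero, zero_add, sub_zero] at h1 h2
  rw [hxz, dist_comm x z, add_mul]
  linarith

/-- Makes the gain of `profile_second_diff` linear in `r` once the distance `D` is at most a
multiple of `r`. -/
theorem div_le_scaled_sq_div {r t D C ρ : ℝ} (hr : 0 < r) (hρ : 0 < ρ) (hD : 0 < D)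
    (ht : r / 2 ≤ t) (hDr : D ≤ C * r) :
    r / (8 * C * ρ) ≤ (t / ρ) ^ 2 / (2 * (D / ρ)) := by
  have hC : 0 < C := pos_of_mul_pos_left (hD.trans_le hDr) hr.le
  have h4 : (t / ρ) ^ 2 / (2 * (D / ρ)) = t ^ 2 / (2 * D * ρ) := by field_simp
  rw [h4, div_le_div_iff₀ (by positivity) (by positivity)]
  have h5 : r ^ 2 ≤ 4 * t ^ 2 := by nlinarith
  have h6 : r * D ≤ r * (C * r) := mul_le_mul_of_nonneg_left hDr hr.le
  have h7 : C * r ^ 2 ≤ C * (4 * t ^ 2) := mul_le_mul_of_nonneg_left h5 hC.le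
  have h8 : r * D ≤ 4 * C * t ^ 2 := by linarith
  have h9 := mul_le_mul_of_nonneg_right h8 (show 0 ≤ 2 * ρ by positivity)
  linarith

/-- Consistency near the boundary, in an almost normal direction along which the barrier is
strongly convex. -/
theorem consistency_boundary (hd : 1 ≤ d) (hΩo : IsOpen Ω) (hΩc : Convex ℝ Ω)
    (hne : (Ωᶜ).Nonempty) (hα : 0 < α) (huH : IsHolder 1 α Ω u) (hM : M.IsFitted Ω)
    (hreg : M.IsRegular σ) (hδ : M.size ≤ δ) (hθ : θ ≤ 1) (S : Directions d θ) {x : Eu d}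
    (hx : x ∈ M.interiorNodes Ω) (hxδ : Metric.infDist x Ωᶜ ≤ (d + 2) * δ) :
    M.size ≤ σ ^ 2 * M.localScale δ x ∧
    ∃ v ∈ S.dirs, (∀ s c s' c', M.IsCombo s c (x + M.localScale δ x • v) →
        M.IsCombo s' c' (x - M.localScale δ x • v) →
        ∑ z ∈ s, c z * u z + ∑ z ∈ s', c' z * u z - 2 * u x ≤
          2 * (holderSeminorm 1 α Ω u * (M.localScale δ x + M.size) ^ (1 + α))) ∧
      M.localScale δ x / (8 * (d + 2 + 1 + σ ^ 2) * ((d + 3) * δ)) ≤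
        profile (Metric.infDist (x + M.localScale δ x • v) Ωᶜ / ((d + 3) * δ)) +
        profile (Metric.infDist (x - M.localScale δ x • v) Ωᶜ / ((d + 3) * δ)) -
        2 * profile (Metric.infDist x Ωᶜ / ((d + 3) * δ)) := by
  have hsz := Mesh.size_pos (M := M) hd
  have hδ0 : 0 < δ := hsz.trans_le hδ
  have hd0 : (0 : ℝ) ≤ d := Nat.cast_nonneg d
  have hσ := hreg.one_le hd
  have hσ2 : 1 ≤ σ ^ 2 := one_le_pow₀ hσ
  have hnodes := hM.nodes_subset hd hΩc
  have hcl := hM.carrier_subset hd hΩc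
  obtain ⟨hxΩ, hxd⟩ := hM.mem_of_interior hd hΩc hΩo hx
  have hr0 := Mesh.localScale_pos hd hδ0 hxd
  have hUnn := holderSeminorm_nonneg 1 α Ω u
  have hfr := hreg.size_le_infDist hd hx.1 hxd
  have hsize : M.size ≤ σ ^ 2 * M.localScale δ x := by
    rw [Mesh.localScale, mul_min_of_nonneg _ _ (by positivity)]
    exact le_min (by nlinarith) hfr
  -- The two distances differ by at most `h`, itself at most `σ²` times the local scale. Hence the
  -- local scale is comparable to the distance to the boundary.
  have hDr : Metric.infDist x Ωᶜ ≤ (d + 2 + 1 + σ ^ 2) * M.localScale δ x := by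
    have h1 := hM.infDist_compl_le hd hΩo x
    rw [Mesh.localScale, mul_min_of_nonneg _ _ (by positivity)]
    have h2 := Mesh.infDist_frontier_pos (M := M) hd hxd
    exact le_min (by nlinarith) (by nlinarith)
  have hrδ : M.localScale δ x ≤ δ := min_le_left _ _
  refine ⟨hsize, ?_⟩
  set r := M.localScale δ x with hr
  set ρ := ((d : ℝ) + 3) * δ with hρ
  have hρ0 : 0 < ρ := by positivity
  set C := (d : ℝ) + 2 + 1 + σ ^ 2 with hC
  have hC0 : 0 < C := by positivity
  obtain ⟨n, H, hn, hle, heq⟩ := exists_support_infDist_compl hΩo hΩc hne (subset_closure hxΩ)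
  obtain ⟨v, hv, hnv⟩ := S.cover n hn
  have hv1 := S.norm_eq_one v hv
  -- Unit vectors at distance at most `θ ≤ 1` enclose an angle of at most 60 degrees.
  have hin : 1 / 2 ≤ inner ℝ n v := by
    have h1 := norm_sub_sq_real n v
    rw [hn, hv1] at h1
    nlinarith [norm_nonneg (n - v)]
  have hin1 : inner ℝ n v ≤ 1 := by
    have := real_inner_le_norm n v
    rwa [hn, hv1, one_mul] at this
  have hmem := Mesh.add_localScale_mem hd hδ0 hxd hv1
  refine ⟨v, hv, fun s c s' c' hc hc' => ?_, ?_⟩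
  · obtain ⟨A, -, -, hA⟩ := huH.exists_taylor hΩo hΩc le_rfl hα hxΩ
    have hstep : ∀ {w : Eu d} {s c}, M.IsCombo s c w → dist w x ≤ r → ∑ z ∈ s, c z * u z ≤
          u x + holderSeminorm 1 α Ω u * (r + M.size) ^ (1 + α) + A (w - x) := by
      intro w s c hc hw
      refine hc.sum_le_of_affine fun z hz => ?_
      have h1 := (abs_le.1 (hA z (hnodes ⟨s, hc.mem, hz⟩))).2
      have h2 : dist z x ^ (1 + α) ≤ (r + M.size) ^ (1 + α) :=
        Real.rpow_le_rpow dist_nonneg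
          (by linarith [dist_triangle z w x, hc.dist_le hz]) (by positivity)
      have h3 := mul_le_mul_of_nonneg_left h2 hUnn
      rw [Nat.cast_one] at h1
      linarith
    have hrv : ‖r • v‖ ≤ r := by rw [norm_smul, hv1, mul_one, Real.norm_of_nonneg hr0.le]
    have h1 := hstep hc (by simpa [dist_eq_norm] using hrv)
    have h2 := hstep hc' (by simpa [dist_eq_norm] using hrv)
    have h4 : A (x + r • v - x) + A (x - r • v - x) = 0 := by
      rw [← map_add]
      convert map_zero A using 2
      module
    linarith
  · set D := Metric.infDist x Ωᶜ with hD
    have hD0 : 0 < D := (hΩo.isClosed_compl.notMem_iff_infDist_pos hne).1 fun h => h hxΩ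
    set t := r * inner ℝ n v with ht
    have hp : Metric.infDist (x + r • v) Ωᶜ ≤ D - t := by
      refine (hle _ (hcl hmem.1)).trans_eq ?_
      rw [heq, inner_add_right, inner_smul_right]; ring
    have hm : Metric.infDist (x - r • v) Ωᶜ ≤ D + t := by
      refine (hle _ (hcl hmem.2)).trans_eq ?_
      rw [heq, inner_sub_right, inner_smul_right]; ring
    have ht0 : r / 2 ≤ t := by rw [ht]; nlinarith
    have ht1 : t ≤ δ := by rw [ht]; nlinarith
    have hDt : 0 ≤ D - t := Metric.infDist_nonneg.trans hp
    -- The choice `ρ = (d+3)δ` ensures `D + t ≤ ρ`, so the arguments stay where the profile is not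
    -- cut off.
    have hsd := profile_second_diff (s := D / ρ) (r := t / ρ) (by positivity)
      (div_nonneg (by linarith) hρ0.le) (div_le_div_of_nonneg_right (by linarith) hρ0.le)
      (by rw [← add_div, div_le_one hρ0]; linarith)
    rw [← add_div, ← sub_div] at hsd
    have h1 := profile_antitone (div_le_div_of_nonneg_right hp hρ0.le)
    have h2 := profile_antitone (div_le_div_of_nonneg_right hm hρ0.le)
    have h3 := div_le_scaled_sq_div hr0 hρ0 hD0 ht0 hDr
    linarith

end

/-! ### Powers -/

/-- The bound `p ≤ 2` replaces `a ^ p` by a constant independent of `k` and `α`. -/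
theorem rpow_mul_le_sq_mul {a b p : ℝ} (ha : 1 ≤ a) (hb : 0 ≤ b) (hp2 : p ≤ 2) :
    (a * b) ^ p ≤ a ^ 2 * b ^ p := by
  rw [Real.mul_rpow (by linarith) hb]
  refine mul_le_mul_of_nonneg_right ?_ (Real.rpow_nonneg hb p)
  rw [← Real.rpow_natCast]
  exact Real.rpow_le_rpow_of_exponent_le ha (by exact_mod_cast hp2)

theorem add_rpow_le_four_mul {a b p : ℝ} (ha : 0 ≤ a) (hb : 0 ≤ b) (hp0 : 0 ≤ p)
    (hp2 : p ≤ 2) : (a + b) ^ p ≤ 4 * (a ^ p + b ^ p) := by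
  have h1 : (a + b) ^ p ≤ (2 * max a b) ^ p :=
    Real.rpow_le_rpow (by positivity)
      (by linarith [le_max_left a b, le_max_right a b]) hp0
  have h2 := rpow_mul_le_sq_mul one_le_two (le_max_of_le_left ha : 0 ≤ max a b) hp2
  have h3 : max a b ^ p ≤ a ^ p + b ^ p := by
    have := Real.rpow_nonneg ha p
    have := Real.rpow_nonneg hb p
    rcases max_choice a b with h | h <;> rw [h] <;> linarith
  linarith

end

/-! ### Assembly of the error estimate. -/

section

variable {d k : ℕ} {Ω : Set (Eu d)} {M : Mesh d} {δ θ α σ : ℝ} {S : Directions d θ}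
  {f u uε : Eu d → ℝ}

/-- The error at the nodes, with the linear growth parameter `η` of the perturbation. -/
theorem IsDiscreteSolution.sub_le_of_pos (hd : 1 ≤ d) (hΩo : IsOpen Ω)
    (hΩb : Bornology.IsBounded Ω) (hΩc : Convex ℝ Ω) (hne : (Ωᶜ).Nonempty) {B : ℝ}
    (hB : ∀ y ∈ closure Ω, ‖y‖ ^ 2 ≤ B) (hk : k ≤ 1) (hα : 0 < α) (hα1 : α ≤ 1)
    (hu : IsEnvelope Ω f u) (hfH : IsHolder k α Ω f) (huH : IsHolder k α Ω u)
    (hM : M.IsFitted Ω) (hreg : M.IsRegular σ) (hδ : M.size ≤ δ) (hθ : θ ≤ 1)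
    (h : IsDiscreteSolution Ω M δ S f uε) {η : ℝ} (hη : 0 < η) :
    ∀ z ∈ M.nodes, uε z - u z ≤
      (holderSeminorm k α Ω f + holderSeminorm k α Ω u) * ((d + 2) * δ) ^ ((k : ℝ) + α) +
      (16 * (d + 2 + 1 + σ ^ 2) * (d + 3) * (1 + σ ^ 2) ^ 2 * holderSeminorm k α Ω u *
          δ ^ ((k : ℝ) + α) +
        (holderSeminorm k α Ω u * (δ * θ + M.size) ^ ((k : ℝ) + α) / δ ^ 2 + η) * B) := by
  have hsz := Mesh.size_pos (M := M) hd
  have hδ0 : 0 < δ := hsz.trans_le hδ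
  have hd0 : (0 : ℝ) ≤ d := Nat.cast_nonneg d
  have hθ0 := S.nonneg hd
  have hUnn := holderSeminorm_nonneg k α Ω u
  have hFnn := holderSeminorm_nonneg k α Ω f
  have hcl := hM.carrier_subset hd hΩc
  set U := holderSeminorm k α Ω u
  set F := holderSeminorm k α Ω f
  set p := (k : ℝ) + α with hp
  have hp0 : 0 ≤ p := by positivity
  set C := (d : ℝ) + 2 + 1 + σ ^ 2 with hC
  have hC0 : 0 < C := by positivity
  set ρ := ((d : ℝ) + 3) * δ with hρ
  have hρ0 : 0 < ρ := by positivity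
  -- For `k = 1`, the lower bound `K r / (8Cρ)` for the barrier's gain is then exactly `2U(1+σ²)² r
  -- δ^α`, which dominates the boundary consistency error.
  set K := 16 * C * (d + 3) * (1 + σ ^ 2) ^ 2 * U * δ ^ p with hK
  have hK0 : 0 ≤ K := by positivity
  -- The quadratic gain `2Eδ²` covers the interior consistency error, and `η` makes the inequality
  -- strict.
  set E := U * (δ * θ + M.size) ^ p / δ ^ 2 + η with hE
  have hE0 : 0 < E := by positivity
  set b : Eu d → ℝ := fun y => profile (Metric.infDist y Ωᶜ / ρ) with hb
  have hbc : ConvexOn ℝ (closure Ω) b := convexOn_profile_infDist hΩo hΩc hne hρ0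
  have hbmid : ∀ {x v : Eu d} {r : ℝ}, x + r • v ∈ closure Ω → x - r • v ∈ closure Ω →
      0 ≤ b (x + r • v) + b (x - r • v) - 2 * b x := by
    intro x v r h1 h2
    have h3 := hbc.2 h1 h2 (show (0 : ℝ) ≤ 1 / 2 by norm_num)
      (show (0 : ℝ) ≤ 1 / 2 by norm_num) (by norm_num)
    rw [show (1 / 2 : ℝ) • (x + r • v) + (1 / 2 : ℝ) • (x - r • v) = x by module,
      smul_eq_mul, smul_eq_mul] at h3
    linarith
  have hGdiff : ∀ {x v : Eu d} {r : ℝ}, ‖v‖ = 1 →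
      (K * b (x + r • v) + E * ‖x + r • v‖ ^ 2) + (K * b (x - r • v) + E * ‖x - r • v‖ ^ 2) -
        2 * (K * b x + E * ‖x‖ ^ 2) =
      K * (b (x + r • v) + b (x - r • v) - 2 * b x) + 2 * E * r ^ 2 := by
    intro x v r hv
    linear_combination E * norm_sq_add_sub x v r hv
  refine h.sub_le hd hΩo hΩc hu hM hδ0 (G := fun y => K * b y + E * ‖y‖ ^ 2)
    ((hbc.smul hK0).add ((convexOn_norm_sq hΩc).smul hE0.le))
    (fun y _ => by have := profile_nonneg (Metric.infDist y Ωᶜ / ρ); positivity)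
    (by positivity) (fun y hy => add_le_add
      (mul_le_of_le_one_right hK0 (profile_le_one _))
      (mul_le_mul_of_nonneg_left (hB y hy) hE0.le)) fun x hx => ?_
  obtain ⟨hxΩ, hxd⟩ := hM.mem_of_interior hd hΩc hΩo hx
  rcases le_total (((d : ℝ) + 2) * δ) (Metric.infDist x Ωᶜ) with hxδ | hxδ
  · obtain ⟨hloc, hgap | ⟨v, hv, hcombo⟩⟩ :=
      consistency_interior hd hΩo hΩb hΩc hk hα hu hfH huH hM hδ S hx hxδ
    · exact Or.inl hgap
    refine Or.inr ⟨v, hv, fun s c s' c' hc hc' => ?_⟩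
    have hv1 := S.norm_eq_one v hv
    have hmem := Mesh.add_localScale_mem hd hδ0 hxd hv1
    rw [hloc] at hc hc' hmem ⊢
    rw [hGdiff hv1]
    have h1 := hcombo s c s' c' hc hc'
    have h2 := mul_nonneg hK0 (hbmid (hcl hmem.1) (hcl hmem.2))
    have h3 : E * δ ^ 2 = U * (δ * θ + M.size) ^ p + η * δ ^ 2 := by
      rw [hE, add_mul, div_mul_cancel₀ _ (by positivity)]
    have h4 : 0 < η * δ ^ 2 := by positivity
    linarith
  obtain rfl | rfl : k = 0 ∨ k = 1 := by omega
  · left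
    refine (gap_boundary_le hΩo hΩc hne hα hu hfH huH hxΩ).trans
      (mul_le_mul_of_nonneg_left ?_ (by positivity))
    rw [hp, Nat.cast_zero, zero_add]
    exact Real.rpow_le_rpow Metric.infDist_nonneg hxδ hα.le
  · right
    obtain ⟨hsize, v, hv, hcombo, hbar⟩ :=
      consistency_boundary hd hΩo hΩc hne hα huH hM hreg hδ hθ S hx hxδ
    refine ⟨v, hv, fun s c s' c' hc hc' => ?_⟩
    rw [hGdiff (S.norm_eq_one v hv)]
    have h1 := hcombo s c s' c' hc hc'
    have hr0 := Mesh.localScale_pos hd hδ0 hxd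
    have hrδ : M.localScale δ x ≤ δ := min_le_left _ _
    set r := M.localScale δ x
    have h2 : K * (r / (8 * C * ρ)) ≤ K * (b (x + r • v) + b (x - r • v) - 2 * b x) :=
      mul_le_mul_of_nonneg_left hbar hK0
    have h3 : K * (r / (8 * C * ρ)) = 2 * (U * ((1 + σ ^ 2) ^ 2 * (r * δ ^ α))) := by
      have h4 : δ ^ p = δ * δ ^ α := by
        rw [hp, Nat.cast_one, Real.rpow_add hδ0, Real.rpow_one]
      rw [hK, h4, hρ]
      field_simp
      ring
    have h4 : (r + M.size) ^ (1 + α) ≤ (1 + σ ^ 2) ^ 2 * (r * δ ^ α) := by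
      calc (r + M.size) ^ (1 + α) ≤ ((1 + σ ^ 2) * r) ^ (1 + α) :=
            Real.rpow_le_rpow (by positivity) (by linarith) (by positivity)
        _ ≤ (1 + σ ^ 2) ^ 2 * r ^ (1 + α) :=
            rpow_mul_le_sq_mul (by nlinarith [sq_nonneg σ]) hr0.le (by linarith)
        _ ≤ _ := by
            rw [Real.rpow_add hr0, Real.rpow_one]
            gcongr
    have h5 := mul_le_mul_of_nonneg_left h4 hUnn
    have h6 : 0 < E * r ^ 2 := by positivity
    linarith

/-- The error of the interpolant is controlled by the error at the nodes. -/
theorem abs_interpolant_sub_le {w : Eu d → ℝ} (hw : M.IsPiecewiseLinear w) {W : ℝ}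
    (h1 : ∀ z ∈ M.nodes, u z ≤ w z) (h2 : ∀ z ∈ M.nodes, w z - u z ≤ W) {x : Eu d}
    (hx : x ∈ M.domain) : |M.interpolant u x - w x| ≤ W := by
  obtain ⟨s, c, hc⟩ := Mesh.exists_isCombo (Mesh.domain_subset_carrier hx)
  -- The bounds hold for every barycentric representation of `x`, so the infimum defining the
  -- interpolant obeys them without uniqueness of its value.
  have key : ∀ {s c}, M.IsCombo s c x →
      w x - W ≤ ∑ z ∈ s, c z * u z ∧ ∑ z ∈ s, c z * u z ≤ w x := by
    intro s c hc
    rw [hc.eq_sum hw]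
    refine ⟨?_, hc.sum_le_sum h1⟩
    have := hc.sum_le_sum (F := fun z => w z - W) (G := u) fun z hz => by linarith [h2 z hz]
    simpa only [mul_sub, Finset.sum_sub_distrib, hc.sum_const] using this
  have hlow : ∀ t ∈ {t : ℝ | ∃ s ∈ M.elements, ∃ c : Eu d → ℝ, (∀ z ∈ s, 0 ≤ c z) ∧
      ∑ z ∈ s, c z = 1 ∧ ∑ z ∈ s, c z • z = x ∧ t = ∑ z ∈ s, c z * u z}, w x - W ≤ t := by
    rintro _ ⟨s, hs, c, hc0, hc1, hcx, rfl⟩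
    exact (key ⟨hs, hc0, hc1, hcx⟩).1
  have hmem : ∑ z ∈ s, c z * u z ∈ {t : ℝ | ∃ s ∈ M.elements, ∃ c : Eu d → ℝ,
      (∀ z ∈ s, 0 ≤ c z) ∧ ∑ z ∈ s, c z = 1 ∧ ∑ z ∈ s, c z • z = x ∧
        t = ∑ z ∈ s, c z * u z} :=
    ⟨s, hc.mem, c, hc.nonneg, hc.sum_one, hc.sum_smul, rfl⟩
  have hA : w x - W ≤ M.interpolant u x := le_csInf ⟨_, hmem⟩ hlow
  have hB : M.interpolant u x ≤ ∑ z ∈ s, c z * u z := csInf_le ⟨_, hlow⟩ hmem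
  have hC := (key hc).2
  have hW : 0 ≤ W := by
    have := (key hc).1
    linarith
  exact abs_le.2 ⟨by linarith, by linarith⟩

end

end TwoScale

open TwoScale in
theorem TwoScale.nonempty_compl_of_isBounded {d : ℕ} (hd : 1 ≤ d) {Ω : Set (Eu d)}
    (hΩb : Bornology.IsBounded Ω) : (Ωᶜ).Nonempty := by
  have := nontrivial_eu hd
  rw [Set.nonempty_compl]
  rintro rfl
  exact noncompact_univ (Eu d) (by simpa using hΩb.isCompact_closure)

theorem theorem3p5 (d : ℕ) (hd : 1 ≤ d) (Ω : Set (TwoScale.Eu d)) (hΩo : IsOpen Ω)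
    (hΩb : Bornology.IsBounded Ω) (hΩc : Convex ℝ Ω) (hΩs : StrictConvex ℝ (closure Ω))
    (σ : ℝ) :
    ∃ C : ℝ, ∀ (k : ℕ) (α : ℝ), k ≤ 1 → 0 < α → α ≤ 1 →
      ∀ f u : TwoScale.Eu d → ℝ,
        (Set.EqOn u (TwoScale.convexEnvelope Ω f) (closure Ω) ∨
          TwoScale.IsViscositySolution Ω f u) →
        TwoScale.IsHolder k α Ω f → TwoScale.IsHolder k α Ω u →
      ∀ M : TwoScale.Mesh d, M.IsRegular σ → M.IsFitted Ω →
      ∀ δ θ : ℝ, M.size ≤ δ → θ ≤ 1 →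
      ∀ (S : TwoScale.Directions d θ) (uε : TwoScale.Eu d → ℝ),
        TwoScale.IsDiscreteSolution Ω M δ S f uε →
      ∀ x ∈ M.domain,
        |M.interpolant u x - uε x| ≤
          C * (TwoScale.holderSeminorm k α Ω u *
                (((δ * θ) ^ ((k : ℝ) + α) + M.size ^ ((k : ℝ) + α) + δ ^ (2 + (k : ℝ) + α))
                  / δ ^ 2)
              + TwoScale.holderSeminorm k α Ω f * δ ^ ((k : ℝ) + α)) := by
  obtain ⟨B, hB0, hB⟩ := TwoScale.exists_pos_forall_abs_le_of_isCompact
    hΩb.isCompact_closure (F := fun x : TwoScale.Eu d => ‖x‖ ^ 2) (by fun_prop)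
  have hB' : ∀ y ∈ closure Ω, ‖y‖ ^ 2 ≤ B := fun y hy => (le_abs_self _).trans (hB y hy)
  have hne := TwoScale.nonempty_compl_of_isBounded hd hΩb
  have hd0 : (0 : ℝ) ≤ d := Nat.cast_nonneg d
  set κ : ℝ := 16 * (d + 2 + 1 + σ ^ 2) * (d + 3) * (1 + σ ^ 2) ^ 2 with hκ
  have hκ0 : 0 ≤ κ := by positivity
  refine ⟨((d : ℝ) + 2) ^ 2 + κ + 4 * B, fun k α hk hα hα1 f u hu hf huH M hreg hfit δ θ hδ hθ S
    uε h x hx => ?_⟩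
  have henv : TwoScale.IsEnvelope Ω f u := hu.elim
    (TwoScale.isEnvelope_of_eqOn_convexEnvelope hΩo hΩb hΩc hΩs hf.continuousOn
      huH.continuousOn)
    (TwoScale.isEnvelope_of_isViscositySolution hd hΩo hΩb hΩc hf.continuousOn)
  have hsz := TwoScale.Mesh.size_pos (M := M) hd
  have hδ0 : 0 < δ := hsz.trans_le hδ
  have hθ0 := S.nonneg hd
  have hUnn := TwoScale.holderSeminorm_nonneg k α Ω u
  have hFnn := TwoScale.holderSeminorm_nonneg k α Ω f
  refine TwoScale.abs_interpolant_sub_le h.piecewiseLinear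
    (h.envelope_le hd hΩo hΩb hΩc henv hfit hδ0) (fun z hz => ?_) hx
  -- With `η = ε / B` the strictness parameter costs exactly `ε`, which is arbitrary.
  have hnode : uε z - u z ≤ _ := le_of_forall_pos_le_add fun ε hε => by
    have := h.sub_le_of_pos hd hΩo hΩb hΩc hne hB' hk hα hα1 henv hf huH hfit hreg hδ hθ
      (η := ε / B) (by positivity) z hz
    rw [add_mul _ (ε / B), div_mul_cancel₀ _ hB0.ne', ← add_assoc, ← add_assoc] at this
    exact this
  refine hnode.trans ?_
  rw [← hκ, show (2 : ℝ) + k + α = 2 + (k + α) by ring]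
  set U := TwoScale.holderSeminorm k α Ω u
  set F := TwoScale.holderSeminorm k α Ω f
  have hp0 : 0 ≤ (k : ℝ) + α := by positivity
  have hp2 : (k : ℝ) + α ≤ 2 := by
    have : (k : ℝ) ≤ 1 := by exact_mod_cast hk
    linarith
  set p := (k : ℝ) + α
  have h1 : ((d + 2) * δ) ^ p ≤ (d + 2) ^ 2 * δ ^ p :=
    TwoScale.rpow_mul_le_sq_mul (by linarith) hδ0.le hp2
  have h2 : (δ * θ + M.size) ^ p ≤ 4 * ((δ * θ) ^ p + M.size ^ p) :=
    TwoScale.add_rpow_le_four_mul (by positivity) hsz.le hp0 hp2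
  -- The third term of the bound absorbs the `U δ^p` contributions of the barrier and of the gap.
  have h3 : δ ^ (2 + p) / δ ^ 2 = δ ^ p := by
    rw [Real.rpow_add hδ0, Real.rpow_two, mul_div_cancel_left₀ _ (by positivity)]
  rw [add_div, h3]
  set Q := ((δ * θ) ^ p + M.size ^ p) / δ ^ 2 with hQ
  have hQ0 : 0 ≤ Q := by positivity
  have hP0 : 0 ≤ δ ^ p := by positivity
  have h4 : U * (δ * θ + M.size) ^ p / δ ^ 2 * B ≤ U * (4 * Q) * B := by
    rw [mul_div_assoc, hQ, ← mul_div_assoc 4]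
    gcongr
  have h5 : (F + U) * ((d + 2) * δ) ^ p ≤ (F + U) * ((d + 2) ^ 2 * δ ^ p) :=
    mul_le_mul_of_nonneg_left h1 (by positivity)
  have h6 : 0 ≤ (((d : ℝ) + 2) ^ 2 + κ) * (U * Q) := by positivity
  have h7 : 0 ≤ 4 * B * (U * δ ^ p) := by positivity
  have h8 : 0 ≤ (κ + 4 * B) * (F * δ ^ p) := by positivity
  calc _ ≤ (F + U) * ((d + 2) ^ 2 * δ ^ p) + κ * U * δ ^ p + U * (4 * Q) * B :=
        add_le_add (add_le_add h5 le_rfl) h4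
    _ ≤ _ := by linarith
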